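/- Let $G$ be a finite simple graph with totally ordered vertex set $V$. A proper set coloring $\kappa$ of $G$ assigns to each vertex a nonempty finite set of positive integers so that adjacent vertices get disjoint sets, and the Kromatic symmetric function of $G$ is $$\overline{X}_G=\sum_{\kappa}\ \prod_{v\in V}\prod_{i\in\kappa(v)}x_i .$$ For $k\ge 1$ let $\overline{p}'_k$ be given by $1+\overline{p}'_k=\prod_{i\ge1}\frac{1}{1-x_i^k}$, and for a partition $\lambda=(\lambda_1,\dots,\lambda_{\ell(\lambda)})$ put $|\lambda|=\sum_i\lambda_i$ and $\overline{p}'_\lambda=\overline{p}'_{\lambda_1}\cdots\overline{p}'_{\lambda_{\ell(\lambda)}}$. **Heaps.** For $\alpha:V\to\mathbb{Z}_{\ge0}$, the graph $\mathsf{Clan}_\alpha(G)$ has $\alpha(v)$ copies of each $v\in V$, two distinct copies being adjacent if they come from the same vertex or from adjacent vertices of $G$. A heap on $G$ of type $\alpha$ is an acyclic orientation of $\mathsf{Clan}_\alpha(G)$, up to permuting the copies of each vertex. The copies are its pieces, its size is $\sum_v\alpha(v)$, and it uses $v$ if $\alpha(v)>0$. A word of a heap is obtained by listing its pieces, with $a$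 before $b$ whenever $a\to b$, and replacing each piece by its vertex. The composition $H_1\circ H_2$ is the heap one of whose words is a word of $H_1$ followed by a word of $H_2$. A heap is periodic if it is $K\circ\cdots\circ K$ ($m>1$ factors) for some heap $K$, and aperiodic otherwise. A pyramid is a heap with a unique source. For a piece $p$ of $H$ write $H=U\circ W$, where $W$ consists of the pieces reachable from $p$ by a directed path, and let $A_p(H)=W\circ U$. A rotation of a pyramid $H$ is a heap with unique source $p$ that is obtained from $H$ by repeatedly applying $A_p$, for a piece $p$ of $H$. The standard word of a heap is its lexicographically largest word, and heaps are compared by comparing standard words lexicographically. A Lyndon heap is an aperiodic pyramid that is minimal among its rotations. **Theorem.** There is a unique family $(c_\lambda)$ of rational numbers, indexed by all partitions, with $\overline{X}_G=\sum_\lambda c_\lambda\,\overline{p}'_\lambda$ (a possibly infinite sum to which, for each monomial, only finitely many terms contribute). Write $[\overline{p}'_\lambda]\overline{X}_G=c_\lambda$. For every partition $\lambda$, the number $$(-1)^{|\lambda|-\ell(\lambda)}\,[\overline{p}'_\lambda]\,\overline{X}_G$$ is equal to the (finite) number of ways to choose a Lyndon heap $L_i$ on $G$ for each part $\lambda_i$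 of $\lambda$, where choices that differ only by permuting the heaps chosen for equal parts are identified (equivalently, the number of multisets of pairs $\{(\lambda_1,L_1),\dots,(\lambda_{\ell(\lambda)},L_{\ell(\lambda)})\}$), such that * each vertex of $G$ is used by at least one $L_i$; * for each $i$, either $L_i$ has size $\lambda_i$, or $\lambda_i/2$ is an odd integer and $L_i$ has size $\lambda_i/2$; * the Lyndon heaps chosen for equal odd parts of $\lambda$ are pairwise distinct. -/

import Mathlib

noncomputable section

namespace KromaticHeaps

/-! ### Power series in the variables `x_1, x_2, …`, indexed by the positive integers -/

/-- A proper set coloring: each vertex gets a nonempty (finite) set of positive integers, and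
adjacent vertices get disjoint sets. (Infinite color sets do not give a monomial.) -/
def IsProperSetColoring {V : Type*} (G : SimpleGraph V) (κ : V → Finset ℕ+) : Prop :=
  (∀ v, (κ v).Nonempty) ∧ ∀ u v, G.Adj u v → Disjoint (κ u) (κ v)

/-- The exponent vector of the monomial `∏_v ∏_{i ∈ κ(v)} x_i`. -/
def colorExponent {V : Type*} [Fintype V] (κ : V → Finset ℕ+) : ℕ+ →₀ ℕ :=
  ∑ v, ∑ i ∈ κ v, Finsupp.single i 1

/-- Only finitely many set colorings contribute to a given monomial. -/
theorem finite_colorings {V : Type*} [Fintype V] (G : SimpleGraph V) (d : ℕ+ →₀ ℕ) :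
    {κ : V → Finset ℕ+ | IsProperSetColoring G κ ∧ colorExponent κ = d}.Finite := by
  classical
  refine Set.Finite.subset
    (Set.Finite.pi' (t := fun _ : V => (d.support.powerset : Set (Finset ℕ+)))
      fun _ => Finset.finite_toSet _) ?_
  rintro κ ⟨-, rfl⟩ v
  simp only [Finset.coe_powerset, Set.mem_preimage, Set.mem_powerset_iff, Finset.coe_subset]
  intro i hi
  have h1 : (colorExponent κ) i = ∑ w, ∑ j ∈ κ w, (Finsupp.single j 1 : ℕ+ →₀ ℕ) i := by
    simp [colorExponent, Finsupp.finsetSum_apply]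
  have h2 : 0 < ∑ w, ∑ j ∈ κ w, (Finsupp.single j 1 : ℕ+ →₀ ℕ) i := by
    refine Finset.sum_pos' (fun _ _ => Nat.zero_le _) ⟨v, Finset.mem_univ v, ?_⟩
    exact Finset.sum_pos' (fun _ _ => Nat.zero_le _) ⟨i, hi, by simp⟩
  rw [Finsupp.mem_support_iff, h1]
  omega

/-- The Kromatic symmetric function: the sum over all proper set colorings `κ` of the monomial
`∏_v ∏_{i ∈ κ(v)} x_i`; its coefficient at a monomial is the number of colorings giving it. -/
def kromatic {V : Type*} [Fintype V] (G : SimpleGraph V) : MvPowerSeries ℕ+ ℚ :=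
  fun d => ({κ : V → Finset ℕ+ | IsProperSetColoring G κ ∧ colorExponent κ = d}.ncard : ℚ)

section Product

open scoped MvPowerSeries.WithPiTopology

/-- The function `p̄'_k`, defined by `1 + p̄'_k = ∏_{i ≥ 1} 1 / (1 - x_i ^ k)`
(an infinite product for coefficientwise convergence of power series). -/
def pBarPrime (k : ℕ) : MvPowerSeries ℕ+ ℚ :=
  (∏' i : ℕ+, (1 - (MvPowerSeries.X i : MvPowerSeries ℕ+ ℚ) ^ k)⁻¹) - 1

/-- The series of the product over the finite set `s` of indices. -/
def pBarPartial (k : ℕ) (s : Finset ℕ+) : MvPowerSeries ℕ+ ℚ := by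
  classical
  exact fun d => if d.support ⊆ s ∧ ∀ i, k ∣ d i then 1 else 0

theorem coeff_pBarPartial (k : ℕ) (s : Finset ℕ+) (d : ℕ+ →₀ ℕ)
    [Decidable (d.support ⊆ s ∧ ∀ i, k ∣ d i)] :
    MvPowerSeries.coeff d (pBarPartial k s) =
      if d.support ⊆ s ∧ ∀ i, k ∣ d i then 1 else 0 := by
  classical
  simp only [pBarPartial, MvPowerSeries.coeff_apply]
  congr

theorem pBarPartial_empty (k : ℕ) : pBarPartial k ∅ = 1 := by
  classical
  ext d
  rw [coeff_pBarPartial, MvPowerSeries.coeff_one]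
  by_cases h : d = 0
  · simp [h]
  · simp [h]

theorem pBarPartial_insert (k : ℕ) (hk : 0 < k) (a : ℕ+) (s : Finset ℕ+) (ha : a ∉ s) :
    pBarPartial k (insert a s) * (1 - (MvPowerSeries.X a : MvPowerSeries ℕ+ ℚ) ^ k) =
      pBarPartial k s := by
  classical
  ext d
  rw [mul_sub, mul_one, map_sub, MvPowerSeries.X_pow_eq, MvPowerSeries.coeff_mul_monomial,
    coeff_pBarPartial, coeff_pBarPartial, coeff_pBarPartial, mul_one]
  have key : ∀ i, (d - Finsupp.single a k) i = if i = a then d i - k else d i := by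
    intro i
    by_cases h : i = a
    · subst h; simp
    · simp [h]
  have hsub : ∀ (e : ℕ+ →₀ ℕ) (t : Finset ℕ+), e.support ⊆ t ↔ ∀ i, i ∉ t → e i = 0 := by
    intro e t
    constructor
    · intro h i hi
      by_contra h0
      exact hi (h (Finsupp.mem_support_iff.2 h0))
    · intro h i hi
      by_contra h0
      exact Finsupp.mem_support_iff.1 hi (h i h0)
  simp only [hsub, key, Finsupp.single_le_iff, Finset.mem_insert, not_or]
  by_cases hle : k ≤ d a
  · have hd : d a ≠ 0 := by omega
    rw [if_pos hle]
    have h3 : ¬ ((∀ i, i ∉ s → d i = 0) ∧ ∀ i, k ∣ d i) := fun h => hd (h.1 a ha)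
    rw [if_neg h3, sub_eq_zero]
    have h4 : ((∀ i, ¬ i = a ∧ i ∉ s → d i = 0) ∧ ∀ i, k ∣ d i) ↔
        ((∀ i, ¬ i = a ∧ i ∉ s → (if i = a then d i - k else d i) = 0) ∧
          ∀ i, k ∣ if i = a then d i - k else d i) := by
      refine and_congr (forall_congr' fun i => ?_) (forall_congr' fun i => ?_)
      · by_cases h : i = a <;> simp [h]
      · by_cases h : i = a
        · subst h
          simp only [if_true]
          exact ⟨fun h => Nat.dvd_sub h (dvd_refl k), fun h => by have := Nat.dvd_add h (dvd_refl k); rwa [Nat.sub_add_cancel hle] at this⟩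
        · simp [h]
    simp only [h4]
  · rw [if_neg hle, sub_zero]
    have h4 : ((∀ i, ¬ i = a ∧ i ∉ s → d i = 0) ∧ ∀ i, k ∣ d i) ↔
        ((∀ i, i ∉ s → d i = 0) ∧ ∀ i, k ∣ d i) := by
      refine and_congr_left fun hdvd => ?_
      refine forall_congr' fun i => ?_
      by_cases h : i = a
      · subst h
        have : d i = 0 := Nat.eq_zero_of_dvd_of_lt (hdvd i) (by omega)
        simp [this]
      · simp [h]
    simp only [h4]

theorem prod_eq_pBarPartial (k : ℕ) (hk : 0 < k) (s : Finset ℕ+) :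
    ∏ i ∈ s, (1 - (MvPowerSeries.X i : MvPowerSeries ℕ+ ℚ) ^ k)⁻¹ = pBarPartial k s := by
  classical
  induction s using Finset.induction_on with
  | empty => simp [pBarPartial_empty]
  | insert a s ha ih =>
    have hc : MvPowerSeries.constantCoeff (1 - (MvPowerSeries.X a : MvPowerSeries ℕ+ ℚ) ^ k) ≠ 0 := by
      simp [hk.ne']
    rw [Finset.prod_insert ha, ih, mul_comm, eq_comm,
      MvPowerSeries.eq_mul_inv_iff_mul_eq hc]
    exact pBarPartial_insert k hk a s ha

/-- The sum of all monomials whose exponents are all divisible by `k`. -/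
def divisibleSeries (k : ℕ) : MvPowerSeries ℕ+ ℚ := by
  classical
  exact fun d => if ∀ i, k ∣ d i then 1 else 0

theorem coeff_divisibleSeries (k : ℕ) (d : ℕ+ →₀ ℕ) [Decidable (∀ i, k ∣ d i)] :
    MvPowerSeries.coeff d (divisibleSeries k) = if ∀ i, k ∣ d i then 1 else 0 := by
  classical
  simp only [divisibleSeries, MvPowerSeries.coeff_apply]
  congr

/-- For `k ≥ 1` the product defining `1 + p̄'_k` converges, and its limit is the sum of all
monomials whose exponents are all divisible by `k`. -/
theorem hasProd_pBarPrime (k : ℕ) (hk : 0 < k) :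
    HasProd (fun i : ℕ+ => (1 - (MvPowerSeries.X i : MvPowerSeries ℕ+ ℚ) ^ k)⁻¹)
      (divisibleSeries k) := by
  classical
  unfold HasProd
  rw [MvPowerSeries.WithPiTopology.tendsto_iff_coeff_tendsto]
  intro d
  refine tendsto_const_nhds.congr' ?_
  rw [SummationFilter.unconditional_filter]
  filter_upwards [Filter.eventually_ge_atTop d.support] with s hs
  rw [prod_eq_pBarPartial k hk, coeff_pBarPartial, coeff_divisibleSeries]
  have : d.support ⊆ s := hs
  simp [this]

theorem pBarPrime_eq (k : ℕ) (hk : 0 < k) : pBarPrime k = divisibleSeries k - 1 := by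
  rw [pBarPrime, (hasProd_pBarPrime k hk).tprod_eq]

end Product

/-- Integer partitions of arbitrary size: `l.1 = |λ|`, and `l.2.parts` is the multiset of parts. -/
abbrev AnyPartition : Type := Σ n : ℕ, n.Partition

/-- The length (number of parts) of a partition. -/
def AnyPartition.length (l : AnyPartition) : ℕ := Multiset.card l.2.parts

/-- `p̄'_λ`, the product of the `p̄'_{λ_i}`. -/
def pBarPrimePart (l : AnyPartition) : MvPowerSeries ℕ+ ℚ := (l.2.parts.map pBarPrime).prod

/-- `f = ∑_λ c_λ p̄'_λ` as a (possibly infinite) linear combination: for each monomial only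
finitely many terms contribute, and the coefficients agree. -/
def IsPBarPrimeExpansion (f : MvPowerSeries ℕ+ ℚ) (c : AnyPartition → ℚ) : Prop :=
  ∀ d : ℕ+ →₀ ℕ,
    (Function.support fun l => c l * MvPowerSeries.coeff d (pBarPrimePart l)).Finite ∧
    MvPowerSeries.coeff d f = ∑ᶠ l, c l * MvPowerSeries.coeff d (pBarPrimePart l)

/-! ### Heaps -/

section Heaps

variable {V : Type*}

/-- The vertices of the `α`-clan graph: `α v` copies of each vertex `v`. -/
abbrev Piece (α : V → ℕ) : Type _ := Σ v : V, Fin (α v)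

/-- The `α`-clan graph of `G`: distinct copies are adjacent if they come from the same vertex or
from adjacent vertices of `G`. -/
def clanGraph (G : SimpleGraph V) (α : V → ℕ) : SimpleGraph (Piece α) where
  Adj a b := a ≠ b ∧ (a.1 = b.1 ∨ G.Adj a.1 b.1)
  symm := ⟨fun _ _ h => ⟨h.1.symm, h.2.imp Eq.symm fun h => h.symm⟩⟩
  loopless := ⟨fun _ h => h.1 rfl⟩

/-- An acyclic orientation of a graph: `rel a b` says that there is an edge directed `a → b`. -/
@[ext] structure AcyclicOrientation {P : Type*} (K : SimpleGraph P) where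
  rel : P → P → Prop
  adj_iff : ∀ a b, K.Adj a b ↔ rel a b ∨ rel b a
  acyclic : ∀ a, ¬ Relation.TransGen rel a a

namespace AcyclicOrientation

variable {P : Type*} {K : SimpleGraph P}

/-- `q` is reachable from `p` by a directed path (of length `≥ 0`). The set of the `q` with
`o.Reach p q` is the pyramid determined by `p`. -/
def Reach (o : AcyclicOrientation K) (p q : P) : Prop := Relation.ReflTransGen o.rel p q

/-- A source: no edge is directed towards it. -/
def IsSource (o : AcyclicOrientation K) (p : P) : Prop := ∀ q, ¬ o.rel q p

/-- The operation `A_p`: if `H = U ∘ W` with `W` the pyramid determined by `p`, then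
`A_p(H) = W ∘ U`. All edges between `U` and `W` are directed from `U` to `W`, and get reversed;
the other edges keep their direction. -/
def rotateAt (o : AcyclicOrientation K) (p : P) : AcyclicOrientation K where
  rel a b := ((o.Reach p a ↔ o.Reach p b) ∧ o.rel a b) ∨
    (¬ (o.Reach p a ↔ o.Reach p b) ∧ o.rel b a)
  adj_iff a b := by
    rw [o.adj_iff a b]
    tauto
  acyclic := by
    have step : ∀ a b, (((o.Reach p a ↔ o.Reach p b) ∧ o.rel a b) ∨
        (¬ (o.Reach p a ↔ o.Reach p b) ∧ o.rel b a)) →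
        (o.Reach p b → o.Reach p a) ∧ ((o.Reach p a ↔ o.Reach p b) → o.rel a b) := by
      intro a b h
      have h1 : o.Reach p b → o.rel b a → o.Reach p a := fun hb hr => hb.tail hr
      tauto
    have main : ∀ a b, Relation.TransGen (fun a b => ((o.Reach p a ↔ o.Reach p b) ∧ o.rel a b) ∨
        (¬ (o.Reach p a ↔ o.Reach p b) ∧ o.rel b a)) a b →
        (o.Reach p b → o.Reach p a) ∧
          ((o.Reach p a ↔ o.Reach p b) → Relation.TransGen o.rel a b) := by
      intro a b h
      induction h with
      | single h =>
        have := step _ _ h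
        exact ⟨this.1, fun h' => .single (this.2 h')⟩
      | @tail b c _ hbc ih =>
        have h2 := step _ _ hbc
        refine ⟨fun h => ih.1 (h2.1 h), fun h => ?_⟩
        have hab : o.Reach p a ↔ o.Reach p b := by tauto
        have hbc' : o.Reach p b ↔ o.Reach p c := by tauto
        exact (ih.2 hab).tail (h2.2 hbc')
    intro a h
    exact o.acyclic a ((main a a h).2 Iff.rfl)

end AcyclicOrientation

/-- Two acyclic orientations of a clan graph are identified if they differ by permuting the copies
of each vertex. -/
def swapSetoid (G : SimpleGraph V) (α : V → ℕ) :
    Setoid (AcyclicOrientation (clanGraph G α)) where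
  r o o' := ∃ σ : ∀ v, Equiv.Perm (Fin (α v)), ∀ a b : Piece α,
    o'.rel ⟨a.1, σ a.1 a.2⟩ ⟨b.1, σ b.1 b.2⟩ ↔ o.rel a b
  iseqv :=
    { refl := fun _ => ⟨fun _ => Equiv.refl _, fun _ _ => Iff.rfl⟩
      symm := by
        rintro o o' ⟨σ, h⟩
        refine ⟨fun v => (σ v).symm, fun a b => ?_⟩
        rw [← h]
        simp
      trans := by
        rintro o o' o'' ⟨σ, h⟩ ⟨τ, h'⟩
        refine ⟨fun v => (σ v).trans (τ v), fun a b => ?_⟩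
        rw [← h, ← h']
        simp }

/-- A heap on `G` of type `α` is an acyclic orientation of the `α`-clan graph, where the copies of
each vertex are indistinguishable. -/
def Heap (G : SimpleGraph V) : Type _ := Σ α : V → ℕ, Quotient (swapSetoid G α)

namespace Heap

variable {G : SimpleGraph V}

/-- The heap given by an acyclic orientation. -/
def mk {α : V → ℕ} (o : AcyclicOrientation (clanGraph G α)) : Heap G :=
  ⟨α, Quotient.mk (swapSetoid G α) o⟩

/-- The number of pieces. -/
def size [Fintype V] (H : Heap G) : ℕ := ∑ v, H.1 v

/-- The vertex `v` is used by `H`. -/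
def Uses (H : Heap G) (v : V) : Prop := 0 < H.1 v

/-- A pyramid is a heap with a unique source. -/
def IsPyramid (H : Heap G) : Prop :=
  ∃ (α : V → ℕ) (o : AcyclicOrientation (clanGraph G α)), H = mk o ∧ ∃! p, o.IsSource p

/-- The words of a heap: list all its pieces so that `a` comes before `b` whenever `a → b`, and
read off the underlying vertices. -/
def words (H : Heap G) : Set (List V) :=
  {w | ∃ (α : V → ℕ) (o : AcyclicOrientation (clanGraph G α)) (l : List (Piece α)), H = mk o ∧
    l.Nodup ∧ (∀ a, a ∈ l) ∧ l.Pairwise (fun a b => ¬ o.rel b a) ∧ w = l.map Sigma.fst}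

/-- `H = K ∘ ⋯ ∘ K` (with `k > 1` factors) for some heap `K`; the composition of heaps is
concatenation of words. -/
def IsPeriodic (H : Heap G) : Prop :=
  ∃ (K : Heap G) (k : ℕ), 1 < k ∧ ∃ u ∈ K.words, (List.replicate k u).flatten ∈ H.words

/-- `H'` is a pyramid obtained from `H` by rotation: for some piece `p`, it is the heap with unique
source `p` reached from `H` by applying `A_p` repeatedly. -/
def IsRotation (H H' : Heap G) : Prop :=
  ∃ (α : V → ℕ) (o : AcyclicOrientation (clanGraph G α)) (p : Piece α) (n : ℕ),
    H = mk o ∧ H' = mk ((fun o' => o'.rotateAt p)^[n] o) ∧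
    ∀ q, ((fun o' => o'.rotateAt p)^[n] o).IsSource q ↔ q = p

/-- `w` is the standard word of `H`: the lexicographically maximal word of `H`. -/
def IsStandardWord [LinearOrder V] (H : Heap G) (w : List V) : Prop := IsGreatest H.words w

/-- The order on heaps: lexicographic comparison of standard words. -/
def StdLE [LinearOrder V] (H H' : Heap G) : Prop :=
  ∃ w w', H.IsStandardWord w ∧ H'.IsStandardWord w' ∧ w ≤ w'

/-- A Lyndon heap is an aperiodic pyramid which is minimal among its rotations. -/
def IsLyndon [LinearOrder V] (H : Heap G) : Prop :=
  H.IsPyramid ∧ ¬ H.IsPeriodic ∧ ∀ H' : Heap G, H.IsRotation H' → H.StdLE H'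

end Heap

/-- The families of Lyndon heaps counted for `λ`: a Lyndon heap `L_i` is chosen for each part
`λ_i`, up to reordering the heaps chosen for equal parts. They are encoded as multisets of pairs
`(λ_i, L_i)`. The conditions are: `|L_i| = λ_i`, or `|L_i| = λ_i / 2` with `λ_i / 2` an odd integer;
each vertex is used; the heaps chosen for equal odd parts are distinct. -/
def lyndonCoverings [Fintype V] [LinearOrder V] (G : SimpleGraph V) (l : AnyPartition) :
    Set (Multiset (ℕ × Heap G)) :=
  {M | M.map Prod.fst = l.2.parts ∧
    (∀ x ∈ M, x.2.IsLyndon ∧ (x.2.size = x.1 ∨ (x.1 = 2 * x.2.size ∧ Odd x.2.size))) ∧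
    (∀ v : V, ∃ x ∈ M, x.2.Uses v) ∧
    (M.filter fun x => Odd x.1).Nodup}

end Heaps

end KromaticHeaps

end

/-! Heaps on $G$ are words in $V$ up to commuting distinct nonadjacent letters. Every class has one
standard (lexicographically largest) word, and a heap is Lyndon exactly when its standard word is a
Lyndon word (`Heap.isLyndon_of_isLyndonWord`, `Heap.isLyndonWord_of_isLyndon`). Lyndon factors of a
standard word are standard, and nonincreasing products of standard Lyndon words are standard, so
heaps correspond to multisets of Lyndon heaps and $\sum_H t^{|H|}=\prod_L(1-t^{|L|})^{-1}$. By
Cartier–Foata (`cartierFoata`) the left side is also the inverse of $\sum_S(-t)^{|S|}$, over stable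
sets $S$. Hence $\sum_S t^{|S|}=\prod_L(1-(-t)^{|L|})$ (`coeff_prod_lyndonWords`), and likewise for
stable sets and heaps avoiding a vertex set $B$.

If empty color sets are allowed, a coloring amounts to an independent choice of a stable set for
each color. Inclusion–exclusion over a set $B$ of uncolored vertices therefore gives $\overline
X_G=\sum_B(-1)^{|B|}\prod_L\prod_i(1-(-x_i)^{|L|})$, with $L$ running over the Lyndon heaps avoiding
$B$ (`coeff_kromatic`).

The factor of a heap of size $n$ is $1/(1+\overline p'_n)$ for even $n$ and $(1+\overline
p'_n)/(1+\overline p'_{2n})$ for odd $n$ (`subst_factorSeries`). In its expansion an odd part occurs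
at most once and with sign $+$, while an even part occurs any number of times, each with sign $-$.
This yields both the rules on sizes and repetitions and the global sign
$(-1)^{|\lambda|-\ell(\lambda)}$; the sum over $B$ turns into the condition that every vertex is
used. Since infinitely many Lyndon heaps may exist, the coefficient of a monomial $x^d$ is computed
with heaps of size at most $\deg d$ only.

Uniqueness (`IsPBarPrimeExpansion.unique`) holds because the lowest-degree part of $\overline
p'_\lambda$ is the power sum $p_\lambda$, and power sums are triangular with respect to monomials.
-/

noncomputable section

namespace KromaticHeaps

/-! ### Lyndon words and the Chen–Fox–Lyndon factorization -/

section Lex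

variable {A : Type*} [LinearOrder A]

theorem append_lt_append_left_iff (s t t' : List A) : s ++ t < s ++ t' ↔ t < t' := by
  induction s with
  | nil => simp
  | cons a s ih => simp [ih]

theorem lt_append_of_ne_nil (s : List A) {t : List A} (ht : t ≠ []) : s < s ++ t := by
  obtain ⟨a, t, rfl⟩ := List.exists_cons_of_ne_nil ht
  have := (append_lt_append_left_iff s [] (a :: t)).2 (List.nil_lt_cons a t)
  simpa using this

theorem le_append_right_self (s t : List A) : s ≤ s ++ t := by
  by_cases ht : t = []
  · simp [ht]
  · exact (lt_append_of_ne_nil s ht).le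

/-- When $s$ is not a prefix of $t$, the comparison is decided at a letter of both words, so
whatever follows is irrelevant. -/
theorem append_lt_append_of_lt {s t : List A} (h : s < t) (hp : ¬ s <+: t) (x y : List A) :
    s ++ x < t ++ y := by
  induction s generalizing t with
  | nil => exact absurd (List.nil_prefix) hp
  | cons a s ih =>
    cases t with
    | nil => simp at h
    | cons b t =>
      rw [List.cons_lt_cons_iff] at h
      rw [List.cons_append, List.cons_append, List.cons_lt_cons_iff]
      rcases h with h | ⟨rfl, h⟩
      · exact Or.inl h
      · refine Or.inr ⟨rfl, ih h ?_⟩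
        rwa [List.prefix_cons_inj] at hp

theorem append_lt_append_of_lt_of_length {s t : List A} (h : s < t) (hl : s.length = t.length)
    (x y : List A) : s ++ x < t ++ y :=
  append_lt_append_of_lt h (fun hp => h.ne (hp.eq_of_length hl)) x y

/-- A Lyndon word: a nonempty word that is smaller than all its proper nonempty suffixes. -/
def IsLyndonWord (w : List A) : Prop :=
  w ≠ [] ∧ ∀ u v, w = u ++ v → u ≠ [] → v ≠ [] → w < v

theorem IsLyndonWord.head_le {a : A} {w : List A} (h : IsLyndonWord (a :: w)) :
    ∀ b ∈ a :: w, a ≤ b := by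
  intro b hb
  obtain ⟨u, v, huv⟩ := List.append_of_mem hb
  rcases eq_or_ne u [] with rfl | hu
  · simp at huv
    exact huv.1.le
  · exact List.head_le_of_lt (h.2 u (b :: v) huv hu (by simp))

/-- A nonempty word has a smallest nonempty suffix. -/
theorem exists_min_suffix (w : List A) (hw : w ≠ []) :
    ∃ u s, w = u ++ s ∧ s ≠ [] ∧ ∀ x y, w = x ++ y → y ≠ [] → s ≤ y := by
  have hne : {y : List A | y <:+ w ∧ y ≠ []}.Nonempty := ⟨w, List.suffix_rfl, hw⟩
  have hfin : {y : List A | y <:+ w ∧ y ≠ []}.Finite := by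
    refine Set.Finite.subset (List.finite_toSet w.tails) ?_
    rintro y ⟨hy, -⟩
    exact (List.mem_tails _ _).2 hy
  obtain ⟨s, hs⟩ := hfin.exists_minimal hne
  obtain ⟨u, hu⟩ := hs.1.1
  refine ⟨u, s, hu.symm, hs.1.2, fun x y hxy hy => ?_⟩
  rcases le_total s y with h | h
  · exact h
  · exact hs.2 ⟨⟨x, hxy.symm⟩, hy⟩ h

/-- Existence of the Lyndon factorization. -/
theorem exists_lyndon_factorization (w : List A) :
    ∃ ls : List (List A), ls.Pairwise (· ≥ ·) ∧ (∀ l ∈ ls, IsLyndonWord l) ∧ ls.flatten = w := by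
  induction hn : w.length using Nat.strong_induction_on generalizing w with
  | _ n ih =>
    rcases eq_or_ne w [] with rfl | hw
    · exact ⟨[], by simp⟩
    obtain ⟨u, s, rfl, hs, hmin⟩ := exists_min_suffix w hw
    have hslen : 0 < s.length := List.length_pos_of_ne_nil hs
    have hsl : IsLyndonWord s := by
      refine ⟨hs, fun x y hxy hx hy => lt_of_le_of_ne (hmin (u ++ x) y (by simp [hxy]) hy) ?_⟩
      intro h
      have := congrArg List.length hxy
      rw [List.length_append, ← h] at this
      have := List.length_pos_of_ne_nil hx
      omega
    obtain ⟨ls, h1, h2, h3⟩ := ih u.length (by simp at hn; omega) u rfl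
    refine ⟨ls ++ [s], ?_, ?_, by simp [h3]⟩
    · rw [List.pairwise_append]
      refine ⟨h1, by simp, ?_⟩
      intro l hl s' hs'
      obtain rfl : s' = s := by simpa using hs'
      -- the last factor of `u` is the smallest suffix of `u`
      rcases List.eq_nil_or_concat ls with rfl | ⟨ls', t, rfl⟩
      · simp at hl
      rw [List.concat_eq_append] at *
      have hlt : t ≤ l := by
        rcases List.mem_append.1 hl with h | h
        · exact (List.pairwise_append.1 h1).2.2 l h t (by simp)
        · simp at h; exact h.ge
      refine le_trans ?_ hlt
      by_contra hts
      rw [not_le] at hts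
      have hu : u = ls'.flatten ++ t := by simp [← h3]
      have htne : t ≠ [] := (h2 t (by simp)).1
      have h5 : s' ≤ t ++ s' := hmin ls'.flatten (t ++ s') (by simp [hu]) (by simp [htne])
      -- Both cases contradict `h5`. If $s'=tr$, then $s'<r$ as $s'$ is Lyndon, so $ts'<tr=s'$.
      -- Otherwise $t<s'$ is decided at a letter, so again $ts'<s'$.
      by_cases hp : t <+: s'
      · obtain ⟨r, hr⟩ := hp
        have hrne : r ≠ [] := by
          rintro rfl
          simp at hr
          exact hts.ne hr
        have h6 := hsl.2 t r hr.symm htne hrne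
        have h7 : t ++ s' < t ++ r := (append_lt_append_left_iff _ _ _).2 h6
        rw [hr] at h7
        exact absurd h5 (not_le.2 h7)
      · have := append_lt_append_of_lt hts hp s' []
        rw [List.append_nil] at this
        exact absurd h5 (not_le.2 this)
    · intro l hl
      rcases List.mem_append.1 hl with h | h
      · exact h2 l h
      · simp at h; exact h ▸ hsl

/-- A suffix starts with a nonempty suffix of some factor $t$, which is at least $t$ because $t$ is
Lyndon, and $t\ge l$. Thus the last factor is determined by the word as its smallest nonempty
suffix. -/
theorem last_le_suffix {ls : List (List A)} {l : List A} (h1 : (ls ++ [l]).Pairwise (· ≥ ·))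
    (h2 : ∀ t ∈ ls ++ [l], IsLyndonWord t) (x y : List A)
    (h : (ls ++ [l]).flatten = x ++ y) (hy : y ≠ []) : l ≤ y := by
  induction ls generalizing x with
  | nil =>
    simp at h h2
    rcases eq_or_ne x [] with rfl | hx
    · simp at h; exact h.le
    · exact (h2.2 x y h hx hy).le
  | cons t ls ih =>
    simp only [List.cons_append, List.flatten_cons] at h
    rw [List.append_eq_append_iff] at h
    have ih' := ih (List.pairwise_cons.1 h1).2 (fun t ht => h2 t (List.mem_cons_of_mem _ ht))
    rcases h with ⟨a, rfl, ha⟩ | ⟨c, hc, rfl⟩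
    · exact ih' a ha
    · rcases eq_or_ne c [] with rfl | hcne
      · exact ih' [] (by simp)
      have ht : l ≤ t := (List.pairwise_cons.1 h1).1 l (by simp)
      refine ht.trans (le_trans ?_ (le_append_right_self c _))
      rcases eq_or_ne x [] with rfl | hx
      · simp at hc; exact hc.le
      · exact ((h2 t (by simp)).2 x c hc hx hcne).le

/-- Uniqueness of the Lyndon factorization. -/
theorem lyndon_factorization_unique {ls ls' : List (List A)} (h1 : ls.Pairwise (· ≥ ·))
    (h2 : ∀ t ∈ ls, IsLyndonWord t) (h1' : ls'.Pairwise (· ≥ ·)) (h2' : ∀ t ∈ ls', IsLyndonWord t)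
    (h : ls.flatten = ls'.flatten) : ls = ls' := by
  induction ls using List.reverseRecOn generalizing ls' with
  | nil =>
    cases ls' with
    | nil => rfl
    | cons t ls' =>
      simp at h
      exact absurd h.1 (h2' t (by simp)).1
  | append_singleton ls l ih =>
    rcases List.eq_nil_or_concat ls' with rfl | ⟨ls', l', rfl⟩
    · simp at h
      exact absurd h.2 (h2 l (by simp)).1
    rw [List.concat_eq_append] at *
    have e : l = l' := le_antisymm
      (last_le_suffix h1 h2 ls'.flatten l' (by simp [h]) (h2' l' (by simp)).1)
      (last_le_suffix h1' h2' ls.flatten l (by simp [← h]) (h2 l (by simp)).1)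
    subst e
    simp at h
    rw [ih (List.pairwise_append.1 h1).1 (fun t ht => h2 t (by simp [ht]))
      (List.pairwise_append.1 h1').1 (fun t ht => h2' t (by simp [ht])) h]

end Lex


/-! ### Words up to commutation and their standard forms -/

section Trace

variable {V : Type*} (G : SimpleGraph V)

/-- Two letters are dependent if they are equal or adjacent; the others commute. -/
def Dep (a b : V) : Prop := a = b ∨ G.Adj a b

variable {G} in
theorem Dep.refl (a : V) : Dep G a a := Or.inl rfl

variable {G} in
theorem Dep.symm {a b : V} (h : Dep G a b) : Dep G b a := h.imp Eq.symm fun h => h.symm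

variable [LinearOrder V]

/-- Equality up to commutations of independent letters, expressed by the projections to pairs of
dependent letters. -/
def TraceEquiv (w w' : List V) : Prop :=
  ∀ a b, Dep G a b → w.filter (fun c => c = a ∨ c = b) = w'.filter (fun c => c = a ∨ c = b)

/-- A word that is lexicographically largest in its class: it has no factor `a u b` with `a < b`
and `b` commuting with all letters of `a u`. -/
def IsStd (w : List V) : Prop :=
  ∀ x a u b y, w = x ++ a :: (u ++ b :: y) → a < b → ∃ c ∈ a :: u, Dep G c b

variable {G}

namespace TraceEquiv

theorem refl (w : List V) : TraceEquiv G w w := fun _ _ _ => rfl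

theorem symm {w w' : List V} (h : TraceEquiv G w w') : TraceEquiv G w' w :=
  fun a b hab => (h a b hab).symm

theorem trans {w w' w'' : List V} (h : TraceEquiv G w w') (h' : TraceEquiv G w' w'') :
    TraceEquiv G w w'' := fun a b hab => (h a b hab).trans (h' a b hab)

theorem append {w w' z z' : List V} (h : TraceEquiv G w w') (h' : TraceEquiv G z z') :
    TraceEquiv G (w ++ z) (w' ++ z') := fun a b hab => by
  rw [List.filter_append, List.filter_append, h a b hab, h' a b hab]

theorem cancel_left {w z z' : List V} (h : TraceEquiv G (w ++ z) (w ++ z')) :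
    TraceEquiv G z z' := fun a b hab => by
  have := h a b hab
  rw [List.filter_append, List.filter_append] at this
  exact List.append_cancel_left this

theorem cancel_cons {a : V} {z z' : List V} (h : TraceEquiv G (a :: z) (a :: z')) :
    TraceEquiv G z z' := cancel_left (w := [a]) h

theorem cons (a : V) {z z' : List V} (h : TraceEquiv G z z') :
    TraceEquiv G (a :: z) (a :: z') := (refl [a]).append h

theorem perm {w w' : List V} (h : TraceEquiv G w w') : w.Perm w' := by
  rw [List.perm_iff_count]
  intro a
  have := congrArg List.length (h a a (Dep.refl a))
  simpa [List.count_eq_length_filter, or_self, Bool.beq_eq_decide_eq] using this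

theorem move_front {x : List V} {b : V} (h : ∀ c ∈ x, ¬ Dep G c b) (y : List V) :
    TraceEquiv G (x ++ b :: y) (b :: (x ++ y)) := by
  intro a d had
  induction x with
  | nil => rfl
  | cons c x ih =>
    have ih' := ih fun c hc => h c (List.mem_cons_of_mem _ hc)
    have hc : ¬ Dep G c b := h c (by simp)
    rw [List.cons_append, List.filter_cons, ih', List.filter_cons, List.filter_cons,
      List.cons_append, List.filter_cons]
    by_cases h1 : c = a ∨ c = d <;> by_cases h2 : b = a ∨ b = d <;> simp only [h1, h2]
    · exfalso
      apply hc
      rcases h1 with rfl | rfl <;> rcases h2 with rfl | rfl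
      · exact Dep.refl _
      · exact had
      · exact had.symm
      · exact Dep.refl _
    all_goals simp

/-- If a letter is first in all projections then it can be moved to the front. -/
theorem exists_front_of_filter {w : List V} {b : V}
    (h : ∀ c, Dep G b c → (w.filter (fun e => e = b ∨ e = c)).head? = some b) :
    ∃ x y, w = x ++ b :: y ∧ ∀ c ∈ x, ¬ Dep G c b := by
  have hb : b ∈ w := by
    have := List.mem_of_mem_head? (h b (Dep.refl b))
    exact (List.mem_filter.1 this).1
  obtain ⟨x, y, rfl, hx⟩ := List.eq_append_cons_of_mem hb
  refine ⟨x, y, rfl, fun c hc hd => hx ?_⟩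
  have h1 := h c hd.symm
  rw [List.filter_append, List.head?_append_of_ne_nil] at h1
  · exact (List.mem_filter.1 (List.mem_of_mem_head? h1)).1
  · exact List.ne_nil_of_mem (List.mem_filter.2 ⟨hc, by simp⟩)

/-- The projections see $b$ ahead of all letters dependent on it, so the first $b$ of $w$ commutes
past everything before it; cancelling it identifies the remainder. -/
theorem exists_front {w y : List V} {b : V} (h : TraceEquiv G w (b :: y)) :
    ∃ x z, w = x ++ b :: z ∧ (∀ c ∈ x, ¬ Dep G c b) ∧ TraceEquiv G (x ++ z) y := by
  obtain ⟨x, z, rfl, hx⟩ := exists_front_of_filter (G := G) (w := w) (b := b) fun c hc => by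
    rw [h b c hc]; simp
  exact ⟨x, z, rfl, hx, cancel_cons ((move_front hx z).symm.trans h)⟩

end TraceEquiv

namespace IsStd

theorem of_append_left {x y : List V} (h : IsStd G (x ++ y)) : IsStd G x := by
  rintro x' a u b y' rfl hab
  exact h x' a u b (y' ++ y) (by simp) hab

theorem of_append_right {x y : List V} (h : IsStd G (x ++ y)) : IsStd G y := by
  rintro x' a u b y' rfl hab
  exact h (x ++ x') a u b y' (by simp) hab

/-- A standard word is the largest word of its class. -/
theorem le {w w' : List V} (hw : IsStd G w) (h : TraceEquiv G w w') : w' ≤ w := by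
  induction w generalizing w' with
  | nil =>
    have := h.perm.length_eq
    rw [List.length_nil, eq_comm, List.length_eq_zero_iff] at this
    exact this.le
  | cons a t ih =>
    cases w' with
    | nil => exact (List.nil_lt_cons _ _).le
    | cons b t' =>
      rcases lt_trichotomy a b with hab | rfl | hab
      · exfalso
        obtain ⟨x, z, hx, hc, -⟩ := h.exists_front
        cases x with
        | nil => simp at hx; exact hab.ne hx.1
        | cons a' x =>
          obtain ⟨rfl, hx⟩ := List.cons_eq_cons.1 hx
          obtain ⟨c, hc', hd⟩ := hw [] a x b z (by simp [hx]) hab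
          exact hc c hc' hd
      · exact List.cons_le_cons a (ih (of_append_right (x := [a]) hw) h.cancel_cons)
      · exact (List.cons_lt_cons_iff.2 (Or.inl hab)).le

theorem eq {w w' : List V} (hw : IsStd G w) (hw' : IsStd G w') (h : TraceEquiv G w w') :
    w = w' := le_antisymm (hw'.le h.symm) (hw.le h)

/-- A forbidden factor $a\,u\,b$ could be rewritten as $b\,a\,u$, which is larger. With `IsStd.le`,
the local condition `IsStd` is equivalent to being the largest word of the class. -/
theorem of_forall_le {w : List V} (h : ∀ w', TraceEquiv G w w' → w' ≤ w) : IsStd G w := by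
  rintro x a u b y rfl hab
  by_contra hc
  push Not at hc
  have h1 := h (x ++ b :: (a :: u ++ y)) (TraceEquiv.append (.refl x) (TraceEquiv.move_front hc y))
  refine absurd h1 (not_le.2 ?_)
  rw [append_lt_append_left_iff]
  exact List.cons_lt_cons_iff.2 (Or.inl hab)

theorem exists_traceEquiv (w : List V) : ∃ w', TraceEquiv G w w' ∧ IsStd G w' := by
  have hfin : {w' | TraceEquiv G w w'}.Finite :=
    (List.finite_toSet w.permutations).subset fun w' h => List.mem_permutations.2 h.perm.symm
  obtain ⟨m, hm⟩ := hfin.exists_maximal ⟨w, TraceEquiv.refl w⟩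
  refine ⟨m, hm.1, of_forall_le fun w' h => ?_⟩
  rcases le_total w' m with h' | h'
  · exact h'
  · exact hm.2 (hm.1.trans h) h'

/-- In a standard word with smallest letter in front, the first letter never commutes past. -/
theorem exists_dep_of_head_le {f b : V} {x y : List V} (h : IsStd G (f :: x ++ b :: y))
    (hf : f ≤ b) : ∃ c ∈ f :: x, Dep G c b := by
  rcases hf.eq_or_lt with rfl | hf
  · exact ⟨f, by simp, Dep.refl f⟩
  · exact h [] f x b y (by simp) hf

/-- Only a factor $a\,u\,b$ straddling the border needs care. Its $b$ is not the $f$ at the border,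
since $a<b$ and $f$ is smallest; so $b$ lies further right, and standardness of $f\,y$ already gives
a letter between, $f$ included, on which $b$ depends. -/
theorem append {x y : List V} {f : V} (hx : IsStd G x) (hy : IsStd G (f :: y))
    (h : ∀ b ∈ x ++ f :: y, f ≤ b) : IsStd G (x ++ f :: y) := by
  intro x' a u b y' he hab
  rw [List.append_eq_append_iff] at he
  rcases he with ⟨t, rfl, ht⟩ | ⟨t, rfl, ht⟩
  · exact hy t a u b y' ht hab
  · cases t with
    | nil =>
      simp only [List.nil_append] at ht
      exact hy [] a u b y' ht.symm hab
    | cons a' t =>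
      rw [List.cons_append, List.cons.injEq] at ht
      obtain ⟨rfl, ht⟩ := ht
      rw [List.append_eq_append_iff] at ht
      rcases ht with ⟨s, rfl, hs⟩ | ⟨s, rfl, hs⟩
      · cases s with
        | nil =>
          obtain ⟨rfl, -⟩ := List.cons_eq_cons.1 hs
          exact absurd (h a (by simp)) (not_le.2 hab)
        | cons b' s =>
          rw [List.cons_append, List.cons.injEq] at hs
          obtain ⟨rfl, hs⟩ := hs
          exact hx x' a u b s rfl hab
      · cases s with
        | nil =>
          obtain ⟨rfl, -⟩ := List.cons_eq_cons.1 hs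
          exact absurd (h a (by simp)) (not_le.2 hab)
        | cons f' s =>
          rw [List.cons_append, List.cons.injEq] at hs
          obtain ⟨rfl, hs⟩ := hs
          have hy' : IsStd G (f :: s ++ b :: y') := by rw [List.cons_append, ← hs]; exact hy
          obtain ⟨c, hc, hd⟩ := hy'.exists_dep_of_head_le (h b (by simp [hs]))
          exact ⟨c, by simp only [List.mem_cons, List.mem_append] at hc ⊢; tauto, hd⟩

/-- A nonincreasing product of standard Lyndon words is standard. -/
theorem flatten {ls : List (List V)} (h1 : ls.Pairwise (· ≥ ·)) (h2 : ∀ l ∈ ls, IsLyndonWord l)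
    (h3 : ∀ l ∈ ls, IsStd G l) : IsStd G ls.flatten := by
  induction ls using List.reverseRecOn with
  | nil => intro x a u b y h; simp at h
  | append_singleton ls l ih =>
    have hl := h2 l (by simp)
    have ih' := ih (List.pairwise_append.1 h1).1 (fun t ht => h2 t (by simp [ht]))
      (fun t ht => h3 t (by simp [ht]))
    obtain ⟨f, y, rfl⟩ := List.exists_cons_of_ne_nil hl.1
    rw [List.flatten_append, List.flatten_singleton]
    -- The first letter of the last factor is smallest: each Lyndon word begins with its smallest
    -- letter, and earlier factors are at least the last one.
    refine ih'.append (h3 _ (by simp)) fun b hb => ?_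
    rcases List.mem_append.1 hb with hb | hb
    · obtain ⟨t, ht, hbt⟩ := List.mem_flatten.1 hb
      have htl := h2 t (by simp [ht])
      have hge : f :: y ≤ t := (List.pairwise_append.1 h1).2.2 t ht _ (by simp)
      obtain ⟨g, z, rfl⟩ := List.exists_cons_of_ne_nil htl.1
      refine le_trans ?_ (htl.head_le b hbt)
      rcases hge.eq_or_lt with h | h
      · simp at h; exact h.1.le
      · exact List.head_le_of_lt h
    · exact hl.head_le b hb

theorem of_mem_flatten {ls : List (List V)} (h : IsStd G ls.flatten) : ∀ l ∈ ls, IsStd G l := by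
  intro l hl
  obtain ⟨s, t, rfl⟩ := List.append_of_mem hl
  rw [List.flatten_append, List.flatten_cons] at h
  exact h.of_append_right.of_append_left

/-- A power of a standard word starting with its smallest letter is standard. -/
theorem flatten_replicate {f : V} {y : List V} (hy : IsStd G (f :: y)) (hf : ∀ b ∈ f :: y, f ≤ b)
    (n : ℕ) : IsStd G (List.replicate n (f :: y)).flatten := by
  induction n with
  | zero => intro x a u b y h; simp at h
  | succ n ih =>
    rw [List.replicate_succ', List.flatten_append, List.flatten_singleton]
    refine ih.append hy fun b hb => hf b ?_
    rcases List.mem_append.1 hb with hb | hb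
    · obtain ⟨t, ht, hbt⟩ := List.mem_flatten.1 hb
      rwa [List.eq_of_mem_replicate ht] at hbt
    · exact hb

end IsStd

/-- Words that commute are powers of a common word. -/
theorem exists_replicate_of_append_comm {A : Type*} {u v : List A} (hu : u ≠ []) (hv : v ≠ [])
    (h : u ++ v = v ++ u) : ∃ (x : List A) (k : ℕ), 1 < k ∧ u ++ v = (List.replicate k x).flatten := by
  -- Euclid's algorithm on the lengths: the shorter word is a prefix of the longer one, and
  -- stripping it leaves a commuting pair.
  suffices H : ∀ n (u v : List A), u.length + v.length = n → u ++ v = v ++ u →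
      ∃ (x : List A) (i j : ℕ), u = (List.replicate i x).flatten ∧
        v = (List.replicate j x).flatten by
    obtain ⟨x, i, j, rfl, rfl⟩ := H _ u v rfl h
    refine ⟨x, i + j, ?_, by rw [List.replicate_add, List.flatten_append]⟩
    have hi : i ≠ 0 := by rintro rfl; simp at hu
    have hj : j ≠ 0 := by rintro rfl; simp at hv
    omega
  intro n
  induction n using Nat.strong_induction_on with
  | _ n ih =>
    intro u v hn h
    rcases eq_or_ne u [] with rfl | hu
    · exact ⟨v, 0, 1, by simp, by simp⟩
    rcases eq_or_ne v [] with rfl | hv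
    · exact ⟨u, 1, 0, by simp, by simp⟩
    have hul := List.length_pos_of_ne_nil hu
    have hvl := List.length_pos_of_ne_nil hv
    have h' := h
    rw [List.append_eq_append_iff] at h'
    rcases h' with ⟨t, rfl, -⟩ | ⟨t, rfl, -⟩
    · rw [List.append_assoc] at h
      have h'' := List.append_cancel_left h
      obtain ⟨x, i, j, hi, hj⟩ := ih (u.length + t.length) (by simp at hn; omega) u t rfl h''
      exact ⟨x, i, i + j, hi, by rw [List.replicate_add, List.flatten_append, ← hi, ← hj]⟩
    · rw [List.append_assoc] at h
      have h'' := List.append_cancel_left h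
      obtain ⟨x, i, j, hi, hj⟩ := ih (t.length + v.length) (by simp at hn; omega) t v rfl h''
      exact ⟨x, j + i, j, by rw [List.replicate_add, List.flatten_append, ← hi, ← hj], hj⟩

/-- A word that is primitive and at most all its rotations starting with its first letter is
Lyndon, if the first letter is the smallest one. -/
theorem isLyndonWord_of_le_rotations {A : Type*} [LinearOrder A] {f : A} {t : List A}
    (hf : ∀ b ∈ f :: t, f ≤ b)
    (hrot : ∀ u v, f :: t = u ++ f :: v → f :: t ≤ f :: v ++ u)
    (hprim : ∀ (x : List A) (k : ℕ), 1 < k → f :: t ≠ (List.replicate k x).flatten) :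
    IsLyndonWord (f :: t) := by
  have hrot' : ∀ u v, f :: t = u ++ v → v ≠ [] → f :: t ≤ v ++ u := by
    intro u v huv hv
    obtain ⟨b, v, rfl⟩ := List.exists_cons_of_ne_nil hv
    rcases (hf b (by simp [huv])).eq_or_lt with rfl | hb
    · exact hrot u v huv
    · exact (List.cons_lt_cons_iff.2 (Or.inl hb)).le
  refine ⟨by simp, fun u v huv hu hv => ?_⟩
  generalize f :: t = w at *
  by_contra hlt
  have hul := List.length_pos_of_ne_nil hu
  have hlen := congrArg List.length huv
  rw [List.length_append] at hlen
  have hvw : v < w := lt_of_le_of_ne (not_lt.1 hlt) (by rintro rfl; omega)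
  have h1 := hrot' u v huv hv
  -- If $w=uv=vs$, comparing $w$ with its rotations $vu$ and $sv$ forces $s=u$. Then $u$ and $v$
  -- commute and $w$ is a proper power. If $v$ is not a prefix, $v<w$ already makes the rotation
  -- $vu$ smaller than $w$.
  by_cases hp : v <+: w
  · obtain ⟨s, hs⟩ := hp
    have hsl := congrArg List.length hs
    rw [List.length_append] at hsl
    have hsne : s ≠ [] := List.ne_nil_of_length_pos (by omega)
    have h2 := hrot' v s hs.symm hsne
    have h3 : s ≤ u := by
      by_contra h
      rw [← hs] at h1
      exact absurd h1 (not_le.2 ((append_lt_append_left_iff v u s).2 (not_le.1 h)))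
    have h4 : s = u := by
      refine h3.antisymm ?_
      by_contra h
      rw [huv] at h2
      exact absurd h2
        (not_le.2 (append_lt_append_of_lt_of_length (not_le.1 h) (by omega) v v))
    subst h4
    obtain ⟨x, k, hk, hx⟩ := exists_replicate_of_append_comm hu hv (huv.symm.trans hs.symm)
    exact hprim x k hk (huv.trans hx)
  · have := append_lt_append_of_lt hvw hp u []
    rw [List.append_nil] at this
    exact absurd h1 (not_le.2 this)

end Trace


/-! ### Generating functions of multisets -/

section SortedLists

variable {A : Type*} [LinearOrder A] (σ : A → ℕ)

/-- The nonincreasing lists with entries in `F` and total size `n`. -/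
def sortedLists (F : Finset A) (n : ℕ) : Set (List A) :=
  {ls | ls.Pairwise (· ≥ ·) ∧ (∀ l ∈ ls, l ∈ F) ∧ (ls.map σ).sum = n}

variable {σ}

/-- As $a$ exceeds all of $F$, a nonincreasing list contains $a$ only if it begins with $a$. The
resulting recursion for the counts is multiplication by $1-t^{\sigma(a)}$. -/
theorem sortedLists_insert {F : Finset A} {a : A} (ha : ∀ b ∈ F, b < a) (n : ℕ) :
    sortedLists σ (insert a F) n = sortedLists σ F n ∪
      {ls | σ a ≤ n ∧ ∃ t ∈ sortedLists σ (insert a F) (n - σ a), ls = a :: t} := by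
  ext ls
  constructor
  · rintro ⟨h1, h2, h3⟩
    cases ls with
    | nil => exact Or.inl ⟨h1, by simp, h3⟩
    | cons b t =>
      rw [List.pairwise_cons] at h1
      rcases Finset.mem_insert.1 (h2 b (by simp)) with rfl | hb
      · refine Or.inr ⟨?_, t, ⟨h1.2, fun l hl => h2 l (by simp [hl]), ?_⟩, rfl⟩ <;>
          simp at h3 <;> omega
      · refine Or.inl ⟨List.pairwise_cons.2 h1, fun l hl => ?_, h3⟩
        have hlb : l ≤ b := by
          rcases List.mem_cons.1 hl with rfl | hl
          · exact le_rfl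
          · exact h1.1 l hl
        rcases Finset.mem_insert.1 (h2 l hl) with rfl | h
        · exact absurd (ha b hb) (not_lt.2 hlb)
        · exact h
  · rintro (⟨h1, h2, h3⟩ | ⟨hle, t, ⟨h1, h2, h3⟩, rfl⟩)
    · exact ⟨h1, fun l hl => Finset.mem_insert_of_mem (h2 l hl), h3⟩
    · refine ⟨List.pairwise_cons.2 ⟨fun l hl => ?_, h1⟩, ?_, ?_⟩
      · rcases Finset.mem_insert.1 (h2 l hl) with rfl | h
        · exact le_rfl
        · exact (ha l h).le
      · intro l hl
        rcases List.mem_cons.1 hl with rfl | hl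
        · simp
        · exact h2 l hl
      · simp [h3]; omega

theorem finite_sortedLists {F : Finset A} (hF : ∀ a ∈ F, 0 < σ a) (n : ℕ) :
    (sortedLists σ F n).Finite := by
  induction F using Finset.induction_on_max generalizing n with
  | empty => exact (Set.finite_singleton []).subset fun ls h =>
      List.eq_nil_iff_forall_not_mem.2 fun l hl => by simpa using h.2.1 l hl
  | insert a F ha ih =>
    induction n using Nat.strong_induction_on with
    | _ n ihn =>
      rw [sortedLists_insert ha]
      refine (ih (fun b hb => hF b (Finset.mem_insert_of_mem hb)) n).union ?_
      by_cases hle : σ a ≤ n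
      · have hpos := hF a (Finset.mem_insert_self _ _)
        refine ((ihn (n - σ a) (by omega)).image (a :: ·)).subset ?_
        rintro _ ⟨-, t, ht, rfl⟩
        exact ⟨t, ht, rfl⟩
      · exact Set.finite_empty.subset fun ls h => hle h.1

theorem ncard_sortedLists_insert {F : Finset A} {a : A} (ha : ∀ b ∈ F, b < a)
    (hF : ∀ b ∈ insert a F, 0 < σ b) (n : ℕ) :
    (sortedLists σ (insert a F) n).ncard = (sortedLists σ F n).ncard +
      if σ a ≤ n then (sortedLists σ (insert a F) (n - σ a)).ncard else 0 := by
  have hfin := finite_sortedLists hF n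
  rw [sortedLists_insert ha] at hfin ⊢
  rw [Set.ncard_union_eq ?_ (hfin.subset Set.subset_union_left)
    (hfin.subset Set.subset_union_right)]
  · congr 1
    split_ifs with hle
    · rw [← Set.ncard_image_of_injective (sortedLists σ (insert a F) (n - σ a))
        (List.cons_injective (a := a))]
      congr 1
      ext ls
      simp only [Set.mem_ofPred_eq, Set.mem_image, hle, true_and, eq_comm]
    · rw [Set.ncard_eq_zero (hfin.subset Set.subset_union_right)]
      exact Set.eq_empty_of_forall_notMem fun ls h => hle h.1
  · rw [Set.disjoint_left]
    rintro _ ⟨-, h2, -⟩ ⟨-, t, -, rfl⟩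
    exact (ha a (h2 a (by simp))).false

open PowerSeries in
theorem prod_one_sub_mul_sortedLists (F : Finset A) (hF : ∀ a ∈ F, 0 < σ a) :
    (∏ a ∈ F, (1 - (X : ℚ⟦X⟧) ^ σ a)) * mk (fun n => ((sortedLists σ F n).ncard : ℚ)) = 1 := by
  induction F using Finset.induction_on_max with
  | empty =>
    ext n
    rw [Finset.prod_empty, one_mul, coeff_mk, coeff_one]
    split_ifs with h
    · have : sortedLists σ ∅ n = {[]} := by
        ext ls
        constructor
        · intro h
          exact List.eq_nil_iff_forall_not_mem.2 fun l hl => by simpa using h.2.1 l hl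
        · rintro rfl
          exact ⟨by simp, by simp, by simp [h]⟩
      simp [this]
    · have : sortedLists σ ∅ n = ∅ := by
        refine Set.eq_empty_of_forall_notMem fun ls hls => h ?_
        have : ls = [] := List.eq_nil_iff_forall_not_mem.2 fun l hl => by simpa using hls.2.1 l hl
        subst this
        simpa using hls.2.2.symm
      simp [this]
  | insert a F ha ih =>
    rw [Finset.prod_insert (fun h => (ha a h).false), mul_comm (1 - _), mul_assoc]
    refine Eq.trans ?_ (ih fun b hb => hF b (Finset.mem_insert_of_mem hb))
    congr 1
    ext n
    rw [sub_mul, one_mul, map_sub, coeff_X_pow_mul', coeff_mk, coeff_mk, coeff_mk,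
      ncard_sortedLists_insert ha hF]
    split_ifs <;> simp

end SortedLists

/-! ### The Cartier–Foata identity and the stable set polynomial -/

section CartierFoata

variable {V : Type*} [LinearOrder V] {G : SimpleGraph V}

theorem TraceEquiv.eq_of_cons {b c : V} {y z : List V} (h : TraceEquiv G (b :: y) (c :: z))
    (hd : Dep G b c) : b = c := by
  have := h b c hd
  simp at this
  exact this.1

theorem TraceEquiv.exists_tail_front {b c : V} {y z : List V}
    (h : TraceEquiv G (b :: y) (c :: z)) (hbc : b ≠ c) : ∃ y', TraceEquiv G y (c :: y') := by
  obtain ⟨x, z', hx, hc, -⟩ := h.exists_front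
  cases x with
  | nil => simp at hx; exact absurd hx.1 hbc
  | cons b' x =>
    rw [List.cons_append, List.cons.injEq] at hx
    obtain ⟨rfl, rfl⟩ := hx
    exact ⟨x ++ z', TraceEquiv.move_front (fun e he => hc e (by simp [he])) z'⟩

/-- Pairwise independent letters can be brought to the front one after another, since removing one
does not block the others. -/
theorem exists_append_iff_forall_front {s u : List V} (hs : s.Pairwise fun a b => ¬ Dep G a b) :
    (∃ y, TraceEquiv G u (s ++ y)) ↔ ∀ b ∈ s, ∃ y, TraceEquiv G u (b :: y) := by
  constructor
  · rintro ⟨y, hy⟩ b hb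
    obtain ⟨s₁, s₂, rfl⟩ := List.append_of_mem hb
    refine ⟨s₁ ++ (s₂ ++ y), hy.trans ?_⟩
    rw [List.append_assoc, List.cons_append]
    exact TraceEquiv.move_front (fun c hc => (List.pairwise_append.1 hs).2.2 c hc b (by simp)) _
  · intro h
    induction s generalizing u with
    | nil => exact ⟨u, TraceEquiv.refl u⟩
    | cons b s ih =>
      rw [List.pairwise_cons] at hs
      obtain ⟨y, hy⟩ := h b (by simp)
      obtain ⟨y', hy'⟩ := ih hs.2 (u := y) fun c hc => by
        obtain ⟨z, hz⟩ := h c (by simp [hc])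
        refine (hy.symm.trans hz).exists_tail_front ?_
        rintro rfl
        exact hs.1 b hc (Dep.refl b)
      exact ⟨y', hy.trans (hy'.cons b)⟩

variable (G) in
/-- The standard word of a class. -/
def stdForm (w : List V) : List V := (IsStd.exists_traceEquiv (G := G) w).choose

theorem traceEquiv_stdForm (w : List V) : TraceEquiv G w (stdForm G w) :=
  (IsStd.exists_traceEquiv w).choose_spec.1

theorem isStd_stdForm (w : List V) : IsStd G (stdForm G w) :=
  (IsStd.exists_traceEquiv w).choose_spec.2

variable [Fintype V]

theorem finite_stdWords (G : SimpleGraph V) (B : Finset V) (n : ℕ) :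
    {w : List V | IsStd G w ∧ w.length = n ∧ ∀ b ∈ w, b ∉ B}.Finite :=
  (List.finite_length_eq V n).subset fun _ h => h.2.1

theorem finite_lyndonWords (G : SimpleGraph V) (B : Finset V) (N : ℕ) :
    {w : List V | IsStd G w ∧ IsLyndonWord w ∧ w.length ≤ N ∧ ∀ b ∈ w, b ∉ B}.Finite :=
  (List.finite_length_le V N).subset fun _ h => h.2.2.1

variable (G) in
/-- The standard words of length `n` without letters in `B`. -/
def stdWords (B : Finset V) (n : ℕ) : Finset (List V) := (finite_stdWords G B n).toFinset

variable (G) in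
/-- The standard Lyndon words of length at most `N` without letters in `B`. -/
def lyndonWords (B : Finset V) (N : ℕ) : Finset (List V) := (finite_lyndonWords G B N).toFinset

theorem mem_stdWords {B : Finset V} {n : ℕ} {w : List V} :
    w ∈ stdWords G B n ↔ IsStd G w ∧ w.length = n ∧ ∀ b ∈ w, b ∉ B := by simp [stdWords]

theorem mem_lyndonWords {B : Finset V} {N : ℕ} {w : List V} :
    w ∈ lyndonWords G B N ↔ IsStd G w ∧ IsLyndonWord w ∧ w.length ≤ N ∧ ∀ b ∈ w, b ∉ B := by
  simp [lyndonWords]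

open scoped Classical in
variable (G) in
/-- The stable sets of `G` that are disjoint from `B`. -/
def stableSets (B : Finset V) : Finset (Finset V) :=
  Finset.univ.filter fun S => (∀ a ∈ S, a ∉ B) ∧ ∀ a ∈ S, ∀ b ∈ S, ¬ G.Adj a b

theorem mem_stableSets {B S : Finset V} :
    S ∈ stableSets G B ↔ (∀ a ∈ S, a ∉ B) ∧ ∀ a ∈ S, ∀ b ∈ S, ¬ G.Adj a b := by
  simp [stableSets]

open scoped Classical in
variable (G) in
/-- The letters that can be moved to the front of a word. -/
def frontLetters (u : List V) : Finset V :=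
  Finset.univ.filter fun b => ∃ y, TraceEquiv G u (b :: y)

theorem mem_frontLetters {u : List V} {b : V} :
    b ∈ frontLetters G u ↔ ∃ y, TraceEquiv G u (b :: y) := by simp [frontLetters]

theorem pairwise_not_dep_toList {S B : Finset V} (hS : S ∈ stableSets G B) :
    S.toList.Pairwise fun a b => ¬ Dep G a b := by
  refine (S.nodup_toList).imp_of_mem fun {a b} ha hb hab h => ?_
  rcases h with h | h
  · exact hab h
  · exact (mem_stableSets.1 hS).2 a (Finset.mem_toList.1 ha) b (Finset.mem_toList.1 hb) h

theorem subset_frontLetters_iff {S B : Finset V} (hS : S ∈ stableSets G B) (u : List V) :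
    S ⊆ frontLetters G u ↔ ∃ y, TraceEquiv G u (S.toList ++ y) := by
  rw [exists_append_iff_forall_front (pairwise_not_dep_toList hS), Finset.subset_iff]
  simp [mem_frontLetters]

open scoped Classical in
-- Left multiplication by the letters of $S$ is injective on classes by cancellation, and its image
-- consists of the classes in which all of $S$ can be moved to the front.
theorem card_filter_subset_frontLetters {S B : Finset V} (hS : S ∈ stableSets G B) (n : ℕ) :
    ((stdWords G B n).filter fun u => S ⊆ frontLetters G u).card =
      if S.card ≤ n then (stdWords G B (n - S.card)).card else 0 := by
  split_ifs with hn
  · symm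
    refine Finset.card_bij (fun w _ => stdForm G (S.toList ++ w)) ?_ ?_ ?_
    · intro w hw
      rw [mem_stdWords] at hw
      have hperm := (traceEquiv_stdForm (G := G) (S.toList ++ w)).perm
      rw [Finset.mem_filter, mem_stdWords, subset_frontLetters_iff hS]
      refine ⟨⟨isStd_stdForm _, ?_, fun b hb => ?_⟩, w, (traceEquiv_stdForm _).symm⟩
      · rw [← hperm.length_eq, List.length_append, Finset.length_toList, hw.2.1]
        omega
      · rcases List.mem_append.1 (hperm.mem_iff.2 hb) with hb | hb
        · exact (mem_stableSets.1 hS).1 b (Finset.mem_toList.1 hb)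
        · exact hw.2.2 b hb
    · intro w hw w' hw' h
      rw [mem_stdWords] at hw hw'
      refine hw.1.eq hw'.1 (TraceEquiv.cancel_left (w := S.toList) ?_)
      refine (traceEquiv_stdForm _).trans ?_
      rw [h]
      exact (traceEquiv_stdForm _).symm
    · intro u hu
      rw [Finset.mem_filter, mem_stdWords, subset_frontLetters_iff hS] at hu
      obtain ⟨⟨h1, h2, h3⟩, y, hy⟩ := hu
      have hy' : TraceEquiv G u (S.toList ++ stdForm G y) :=
        hy.trans ((TraceEquiv.refl _).append (traceEquiv_stdForm y))
      refine ⟨stdForm G y, mem_stdWords.2 ⟨isStd_stdForm _, ?_, fun b hb => ?_⟩, ?_⟩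
      · have := hy'.perm.length_eq
        rw [List.length_append, Finset.length_toList] at this
        omega
      · exact h3 b (hy'.perm.mem_iff.2 (by simp [hb]))
      · exact (isStd_stdForm _).eq h1 ((traceEquiv_stdForm _).symm.trans hy'.symm)
  · rw [Finset.card_eq_zero, Finset.filter_eq_empty_iff]
    intro u hu h
    obtain ⟨y, hy⟩ := (subset_frontLetters_iff hS u).1 h
    have := hy.perm.length_eq
    rw [List.length_append, Finset.length_toList, (mem_stdWords.1 hu).2.1] at this
    omega

open scoped Classical in
-- Adjacent letters cannot both be movable to the front, so every set of front letters is stable and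
-- avoids $B$. The alternating sum thus runs over all subsets of a nonempty set.
theorem sum_stableSets_subset_frontLetters {B : Finset V} {n : ℕ} (hn : n ≠ 0) {u : List V}
    (hu : u ∈ stdWords G B n) :
    ∑ S ∈ stableSets G B, (if S ⊆ frontLetters G u then (-1 : ℚ) ^ S.card else 0) = 0 := by
  rw [← Finset.sum_filter]
  have : (stableSets G B).filter (· ⊆ frontLetters G u) = (frontLetters G u).powerset := by
    ext S
    rw [Finset.mem_filter, Finset.mem_powerset, and_iff_right_iff_imp]
    intro hS
    have hS' := fun a ha => mem_frontLetters.1 (hS (x := a) ha)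
    refine mem_stableSets.2 ⟨fun a ha => ?_, fun a ha b hb hab => ?_⟩
    · obtain ⟨y, hy⟩ := hS' a ha
      exact (mem_stdWords.1 hu).2.2 a (hy.perm.mem_iff.2 (by simp))
    · obtain ⟨y, hy⟩ := hS' a ha
      obtain ⟨z, hz⟩ := hS' b hb
      exact hab.ne ((hy.symm.trans hz).eq_of_cons (Or.inr hab))
  rw [this]
  have hne : (frontLetters G u).Nonempty := by
    obtain ⟨b, y, rfl⟩ := List.exists_cons_of_ne_nil
      (List.ne_nil_of_length_pos (by rw [(mem_stdWords.1 hu).2.1]; omega) : u ≠ [])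
    exact ⟨b, mem_frontLetters.2 ⟨y, TraceEquiv.refl _⟩⟩
  have := Finset.sum_powerset_neg_one_pow_card_of_nonempty hne
  exact_mod_cast congrArg (Int.cast : ℤ → ℚ) this

open PowerSeries

theorem stdWords_zero (B : Finset V) : stdWords G B 0 = {[]} := by
  ext w
  rw [mem_stdWords, Finset.mem_singleton, List.length_eq_zero_iff]
  constructor
  · exact fun h => h.2.1
  · rintro rfl
    exact ⟨fun x a u b y h => by simp at h, rfl, by simp⟩

/-- The Cartier–Foata identity. -/
theorem cartierFoata (B : Finset V) :
    (∑ S ∈ stableSets G B, (-1 : ℚ⟦X⟧) ^ S.card * X ^ S.card) *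
      mk (fun n => ((stdWords G B n).card : ℚ)) = 1 := by
  classical
  ext n
  have key : coeff n ((∑ S ∈ stableSets G B, (-1 : ℚ⟦X⟧) ^ S.card * X ^ S.card) *
      mk (fun n => ((stdWords G B n).card : ℚ))) = ∑ S ∈ stableSets G B,
      (-1 : ℚ) ^ S.card * ((stdWords G B n).filter fun u => S ⊆ frontLetters G u).card := by
    rw [Finset.sum_mul, map_sum]
    refine Finset.sum_congr rfl fun S hS => ?_
    have : (-1 : ℚ⟦X⟧) ^ S.card = C ((-1 : ℚ) ^ S.card) := by simp
    rw [card_filter_subset_frontLetters hS, this, mul_assoc, coeff_C_mul, coeff_X_pow_mul',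
      coeff_mk]
    split_ifs <;> simp
  rw [key, coeff_one]
  split_ifs with hn
  · subst hn
    rw [Finset.sum_eq_single ∅]
    · simp [stdWords_zero]
    · intro S hS hne
      have := Finset.card_pos.2 (Finset.nonempty_iff_ne_empty.2 hne)
      rw [card_filter_subset_frontLetters hS, if_neg (by omega)]
      simp
    · intro h
      exact absurd (mem_stableSets.2 (by simp)) h
  · have : ∀ S ∈ stableSets G B, (-1 : ℚ) ^ S.card *
        ((stdWords G B n).filter fun u => S ⊆ frontLetters G u).card =
        ∑ u ∈ stdWords G B n, if S ⊆ frontLetters G u then (-1 : ℚ) ^ S.card else 0 := by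
      intro S _
      rw [← Finset.sum_filter, Finset.sum_const, nsmul_eq_mul, mul_comm]
    rw [Finset.sum_congr rfl this, Finset.sum_comm]
    exact Finset.sum_eq_zero fun u hu => sum_stableSets_subset_frontLetters hn hu

/-- Concatenation is a bijection by the Lyndon factorization, standardness passing in both
directions between a word and its factors. Factors of a word of length $n\le N$ are short enough to
lie in the finite set. -/
theorem ncard_sortedLists_lyndonWords (B : Finset V) {n N : ℕ} (hn : n ≤ N) :
    (sortedLists List.length (lyndonWords G B N) n).ncard = (stdWords G B n).card := by
  rw [← Set.ncard_coe_finset, ← Set.InjOn.ncard_image (f := List.flatten)]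
  · congr 1
    ext w
    rw [Finset.mem_coe, mem_stdWords]
    constructor
    · rintro ⟨ls, ⟨h1, h2, h3⟩, rfl⟩
      have h2' := fun l hl => mem_lyndonWords.1 (h2 l hl)
      refine ⟨IsStd.flatten h1 (fun l hl => (h2' l hl).2.1) (fun l hl => (h2' l hl).1),
        by rw [List.length_flatten, h3], fun b hb => ?_⟩
      obtain ⟨l, hl, hb⟩ := List.mem_flatten.1 hb
      exact (h2' l hl).2.2.2 b hb
    · rintro ⟨h1, h2, h3⟩
      obtain ⟨ls, hs, hl, rfl⟩ := exists_lyndon_factorization w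
      refine ⟨ls, ⟨hs, fun l hl' => mem_lyndonWords.2 ⟨h1.of_mem_flatten l hl', hl l hl', ?_,
        fun b hb => h3 b (List.mem_flatten.2 ⟨l, hl', hb⟩)⟩, by rw [← List.length_flatten, h2]⟩,
        rfl⟩
      refine le_trans ?_ hn
      rw [← h2, List.length_flatten]
      exact List.single_le_sum (by simp) _ (List.mem_map_of_mem hl')
  · rintro ls ⟨h1, h2, -⟩ ls' ⟨h1', h2', -⟩ h
    exact lyndon_factorization_unique h1 (fun l hl => (mem_lyndonWords.1 (h2 l hl)).2.1) h1'
      (fun l hl => (mem_lyndonWords.1 (h2' l hl)).2.1) h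

/-- The product over Lyndon words of `1 - (-t) ^ |L|` is the generating polynomial of stable
sets. -/
theorem coeff_prod_lyndonWords (B : Finset V) {n N : ℕ} (hn : n ≤ N) :
    coeff n (∏ w ∈ lyndonWords G B N, (1 - (-X : ℚ⟦X⟧) ^ w.length)) =
      (((stableSets G B).filter fun S => S.card = n).card : ℚ) := by
  set P : ℚ⟦X⟧ := ∏ w ∈ lyndonWords G B N, ((1 : ℚ⟦X⟧) - X ^ w.length) with hP
  set J : ℚ⟦X⟧ := ∑ S ∈ stableSets G B, (-1 : ℚ⟦X⟧) ^ S.card * X ^ S.card with hJ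
  set H : ℚ⟦X⟧ := mk (fun n => ((stdWords G B n).card : ℚ)) with hH
  set H' : ℚ⟦X⟧ := mk (fun n =>
    ((sortedLists List.length (lyndonWords G B N) n).ncard : ℚ)) with hH'
  have h1 : J * H = 1 := cartierFoata B
  have h2 : P * H' = 1 := prod_one_sub_mul_sortedLists _ fun w hw =>
    List.length_pos_of_ne_nil (mem_lyndonWords.1 hw).2.1.1
  -- Truncating to Lyndon words of length at most $N$ changes nothing up to degree $N$; inverses of
  -- series agreeing to that order agree to the same order.
  have h3 : X ^ (N + 1) ∣ H' - H := by
    rw [X_pow_dvd_iff]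
    intro m hm
    rw [map_sub, coeff_mk, coeff_mk, ncard_sortedLists_lyndonWords B (by omega), sub_self]
  have h4 : X ^ (N + 1) ∣ J - P := by
    have : J - P = J * P * (H' - H) := by linear_combination P * h1 - J * h2
    rw [this]
    exact h3.mul_left _
  have h5 : coeff n P = coeff n J := by
    have := X_pow_dvd_iff.1 h4 n (by omega)
    rw [map_sub, sub_eq_zero] at this
    exact this.symm
  -- Replacing $t$ by $-t$ removes the signs of the stable set polynomial and moves them into the
  -- product.
  have h6 : (∏ w ∈ lyndonWords G B N, (1 - (-X : ℚ⟦X⟧) ^ w.length)) = rescale (-1 : ℚ) P := by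
    rw [hP, map_prod]
    refine Finset.prod_congr rfl fun w _ => ?_
    rw [map_sub, map_one, map_pow, rescale_X]
    simp
  rw [h6, coeff_rescale, h5, hJ, map_sum, Finset.mul_sum, Finset.card_filter, Nat.cast_sum]
  refine Finset.sum_congr rfl fun S _ => ?_
  have : (-1 : ℚ⟦X⟧) ^ S.card = C ((-1 : ℚ) ^ S.card) := by simp
  rw [this, coeff_C_mul, coeff_X_pow]
  by_cases h : n = S.card
  · subst h
    simp [← mul_pow]
  · rw [if_neg h, if_neg (Ne.symm h)]
    simp

end CartierFoata


/-! ### Relative order of two entries of a list -/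

section ListPairs

variable {P : Type*}

theorem pair_sublist_or {l : List P} {a b : P} (ha : a ∈ l) (hb : b ∈ l) (hab : a ≠ b) :
    [a, b].Sublist l ∨ [b, a].Sublist l := by
  induction l with
  | nil => simp at ha
  | cons c t ih =>
    rcases List.mem_cons.1 ha with rfl | ha'
    · exact Or.inl ((List.singleton_sublist.2 (List.mem_of_ne_of_mem hab.symm hb)).cons_cons _)
    rcases List.mem_cons.1 hb with rfl | hb'
    · exact Or.inr ((List.singleton_sublist.2 ha').cons_cons _)
    exact (ih ha' hb').imp (fun h => h.cons _) (fun h => h.cons _)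

theorem pair_sublist_asymm {l : List P} (hl : l.Nodup) {a b : P} (h : [a, b].Sublist l) :
    ¬ [b, a].Sublist l := by
  induction l with
  | nil => simp at h
  | cons c t ih =>
    rw [List.nodup_cons] at hl
    intro h'
    rw [List.cons_sublist_cons'] at h h'
    rcases h with h | ⟨rfl, h⟩
    · rcases h' with h' | ⟨rfl, h'⟩
      · exact ih hl.2 h h'
      · exact hl.1 (h.subset (by simp))
    · rcases h' with h' | ⟨rfl, h'⟩
      · exact hl.1 (h'.subset (by simp))
      · exact hl.1 (h'.subset (by simp))

theorem pair_sublist_map_iff {Q : Type*} {f : P → Q} {l : List P} (hl : (l.map f).Nodup) {a b : P}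
    (ha : a ∈ l) (hb : b ∈ l) (hab : a ≠ b) :
    [f a, f b].Sublist (l.map f) ↔ [a, b].Sublist l := by
  refine ⟨fun h => (pair_sublist_or ha hb hab).resolve_right fun h' => ?_, fun h => h.map f⟩
  exact pair_sublist_asymm hl h (h'.map f)

theorem pair_sublist_filter_iff {l : List P} {p : P → Bool} {a b : P} (ha : p a) (hb : p b) :
    [a, b].Sublist (l.filter p) ↔ [a, b].Sublist l := by
  refine ⟨fun h => h.trans List.filter_sublist, fun h => ?_⟩
  have := h.filter p
  simpa [ha, hb] using this

end ListPairs

/-! ### Numbering the occurrences of letters -/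

section Numbering

variable {V : Type*} [DecidableEq V]

/-- Number the occurrences of each letter of a word, from the right. -/
def number : List V → List (V × ℕ)
  | [] => []
  | v :: t => (v, t.count v) :: number t

theorem map_fst_number (w : List V) : (number w).map Prod.fst = w := by
  induction w with
  | nil => rfl
  | cons v t ih => simp [number, ih]

theorem mem_number {w : List V} {x : V × ℕ} : x ∈ number w ↔ x.2 < w.count x.1 := by
  obtain ⟨v, k⟩ := x
  induction w with
  | nil => simp [number]
  | cons u t ih =>
    simp only [number, List.mem_cons, Prod.mk.injEq, ih, List.count_cons]
    by_cases h : u = v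
    · subst h; simp; omega
    · simp [h, Ne.symm h]

theorem nodup_number (w : List V) : (number w).Nodup := by
  induction w with
  | nil => simp [number]
  | cons u t ih => exact List.nodup_cons.2 ⟨fun h => by simpa using mem_number.1 h, ih⟩

/-- The number of an occurrence depends only on occurrences of the same letter, all of which are
kept or dropped together. Hence the order of two numbered dependent letters can be read off a
projection. -/
theorem filter_number (p : V → Bool) (w : List V) :
    (number w).filter (fun x => p x.1) = number (w.filter p) := by
  induction w with
  | nil => rfl
  | cons u t ih =>
    by_cases h : p u
    · simp [number, h, ih, List.count_filter]
    · simp [number, h, ih]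

theorem exists_map_eq_number {P : Type*} (π : P → V) {l : List P} (hl : l.Nodup) :
    ∃ f : P → V × ℕ, l.map f = number (l.map π) := by
  classical
  induction l with
  | nil => exact ⟨fun a => (π a, 0), rfl⟩
  | cons a t ih =>
    rw [List.nodup_cons] at hl
    obtain ⟨f, hf⟩ := ih hl.2
    refine ⟨Function.update f a (π a, (t.map π).count (π a)), ?_⟩
    rw [List.map_cons, List.map_cons, number, Function.update_self, ← hf]
    congr 1
    refine List.map_congr_left fun b hb => Function.update_of_ne ?_ _ _
    rintro rfl
    exact hl.1 hb

end Numbering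

/-! ### Heaps and their linear extensions -/

section Realization

variable {V : Type*} {G : SimpleGraph V} {α α' : V → ℕ}

/-- `l` lists all pieces, with `a` before `b` whenever `a → b`. -/
structure Realizes (o : AcyclicOrientation (clanGraph G α)) (l : List (Piece α)) : Prop where
  nodup : l.Nodup
  mem : ∀ a, a ∈ l
  pairwise : l.Pairwise fun a b => ¬ o.rel b a

theorem AcyclicOrientation.irrefl {P : Type*} {K : SimpleGraph P} (o : AcyclicOrientation K)
    (a : P) : ¬ o.rel a a := fun h => o.acyclic a (.single h)

theorem Realizes.not_rel {o : AcyclicOrientation (clanGraph G α)} {l : List (Piece α)}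
    (h : Realizes o l) {a b : Piece α} (hab : [a, b].Sublist l) : ¬ o.rel b a :=
  List.pairwise_iff_forall_sublist.1 h.pairwise hab

theorem Realizes.rel_iff {o : AcyclicOrientation (clanGraph G α)} {l : List (Piece α)}
    (h : Realizes o l) (a b : Piece α) :
    o.rel a b ↔ (clanGraph G α).Adj a b ∧ [a, b].Sublist l := by
  constructor
  · intro hab
    have hadj := (o.adj_iff a b).2 (Or.inl hab)
    exact ⟨hadj, (pair_sublist_or (h.mem a) (h.mem b) hadj.1).resolve_right
      fun h' => h.not_rel h' hab⟩
  · rintro ⟨hadj, hs⟩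
    exact ((o.adj_iff a b).1 hadj).resolve_right (h.not_rel hs)

theorem AcyclicOrientation.wellFounded_transGen {P : Type*} {K : SimpleGraph P} [Finite P]
    (o : AcyclicOrientation K) :
    WellFounded (Relation.TransGen o.rel) := by
  have : Std.Irrefl (Relation.TransGen o.rel) := ⟨o.acyclic⟩
  exact Finite.wellFounded_of_trans_of_irrefl _

theorem exists_realizes [Fintype V] (o : AcyclicOrientation (clanGraph G α)) :
    ∃ l, Realizes o l := by
  classical
  suffices H : ∀ S : Finset (Piece α), ∃ l : List (Piece α), l.Nodup ∧ (∀ a, a ∈ l ↔ a ∈ S) ∧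
      l.Pairwise fun a b => ¬ o.rel b a by
    obtain ⟨l, h1, h2, h3⟩ := H Finset.univ
    exact ⟨l, h1, fun a => (h2 a).2 (Finset.mem_univ a), h3⟩
  intro S
  induction S using Finset.strongInduction with
  | H S ih =>
    rcases S.eq_empty_or_nonempty with rfl | hne
    · exact ⟨[], by simp⟩
    obtain ⟨m, hm, hmin⟩ := o.wellFounded_transGen.has_min (S : Set (Piece α)) hne
    obtain ⟨l, h1, h2, h3⟩ := ih (S.erase m) (Finset.erase_ssubset hm)
    refine ⟨m :: l, ?_, ?_, ?_⟩
    · exact List.nodup_cons.2 ⟨fun h => by simpa using (h2 m).1 h, h1⟩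
    · intro a
      rw [List.mem_cons, h2, Finset.mem_erase]
      by_cases h : a = m
      · subst h; simpa using hm
      · simp [h]
    · exact List.pairwise_cons.2 ⟨fun b hb hr =>
        hmin b (Finset.mem_of_mem_erase ((h2 b).1 hb)) (.single hr), h3⟩

theorem Realizes.count_map_fst [DecidableEq V] {o : AcyclicOrientation (clanGraph G α)}
    {l : List (Piece α)} (h : Realizes o l) (v : V) : (l.map Sigma.fst).count v = α v := by
  classical
  have h1 : (l.map Sigma.fst).count v = (l.filter fun a => a.1 = v).length := by
    rw [List.count_eq_length_filter, List.filter_map, List.length_map]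
    congr 1
  have h2 : (l.filter fun a => a.1 = v).Perm ((List.finRange (α v)).map (Sigma.mk v)) := by
    rw [List.perm_ext_iff_of_nodup (h.nodup.filter _)
      ((List.nodup_finRange _).map sigma_mk_injective)]
    rintro ⟨u, k⟩
    simp only [List.mem_filter, h.mem, decide_eq_true_eq, true_and, List.mem_map,
      List.mem_finRange]
    constructor
    · rintro rfl
      exact ⟨k, rfl⟩
    · rintro ⟨k', hk⟩
      exact (congrArg Sigma.fst hk).symm
  rw [h1, h2.length_eq]
  simp

namespace Heap

theorem exists_of_mk_eq {o : AcyclicOrientation (clanGraph G α)}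
    {o' : AcyclicOrientation (clanGraph G α')} (h : mk o = mk o') :
    ∃ e : Piece α ≃ Piece α', (∀ a, (e a).1 = a.1) ∧ ∀ a b, o'.rel (e a) (e b) ↔ o.rel a b := by
  obtain rfl : α = α' := congrArg Sigma.fst h
  have h1 : Quotient.mk (swapSetoid G α) o = Quotient.mk (swapSetoid G α) o' :=
    eq_of_heq (Sigma.mk.inj h).2
  obtain ⟨σ, hσ⟩ := Quotient.exact h1
  exact ⟨Equiv.sigmaCongrRight σ, fun a => rfl, fun a b => hσ a b⟩

/-- A label-preserving bijection of pieces restricts to the copies of each vertex: this forces equal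
types and is a permutation of copies. -/
theorem mk_eq_of_equiv {o : AcyclicOrientation (clanGraph G α)}
    {o' : AcyclicOrientation (clanGraph G α')} (e : Piece α ≃ Piece α') (he : ∀ a, (e a).1 = a.1)
    (h : ∀ a b, o'.rel (e a) (e b) ↔ o.rel a b) : mk o = mk o' := by
  have key : ∀ v, ∃ τ : Fin (α v) ≃ Fin (α' v), ∀ k, e ⟨v, k⟩ = ⟨v, τ k⟩ := by
    intro v
    have h1 : ∀ k : Fin (α v), ∃ k' : Fin (α' v), e ⟨v, k⟩ = ⟨v, k'⟩ := by
      intro k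
      have h2 := he ⟨v, k⟩
      revert h2
      generalize e ⟨v, k⟩ = x
      rintro h2
      obtain ⟨u, k'⟩ := x
      obtain rfl : u = v := h2
      exact ⟨k', rfl⟩
    choose τ hτ using h1
    refine ⟨Equiv.ofBijective τ ⟨fun k k' hk => ?_, fun k' => ?_⟩, hτ⟩
    · have : e ⟨v, k⟩ = e ⟨v, k'⟩ := by rw [hτ, hτ, hk]
      exact eq_of_heq (Sigma.mk.inj (e.injective this)).2
    · obtain ⟨⟨u, k⟩, hk⟩ := e.surjective ⟨v, k'⟩
      obtain rfl : u = v := (he ⟨u, k⟩).symm.trans (congrArg Sigma.fst hk)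
      exact ⟨k, eq_of_heq (Sigma.mk.inj ((hτ k).symm.trans hk)).2⟩
  obtain rfl : α = α' := by
    funext v
    obtain ⟨τ, -⟩ := key v
    simpa using Fintype.card_congr τ
  choose τ hτ using key
  unfold mk
  congr 1
  refine Quotient.sound ⟨τ, fun a b => ?_⟩
  rw [← h a b]
  exact iff_of_eq (congrArg₂ o'.rel (hτ a.1 a.2).symm (hτ b.1 b.2).symm)

theorem mem_words_mk {o : AcyclicOrientation (clanGraph G α)} {w : List V} :
    w ∈ (mk o).words ↔ ∃ l, Realizes o l ∧ w = l.map Sigma.fst := by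
  constructor
  · rintro ⟨α', o', l, h, h1, h2, h3, rfl⟩
    obtain ⟨e, he, hr⟩ := exists_of_mk_eq h.symm
    refine ⟨l.map e, ⟨h1.map e.injective, fun a => ?_, ?_⟩, ?_⟩
    · exact List.mem_map.2 ⟨e.symm a, h2 _, by simp⟩
    · rw [List.pairwise_map]
      exact h3.imp fun {a b} h => by rwa [hr]
    · rw [List.map_map]
      exact List.map_congr_left fun a _ => (he a).symm
  · rintro ⟨l, h, rfl⟩
    exact ⟨α, o, l, rfl, h.nodup, h.mem, h.pairwise, rfl⟩

theorem exists_mk (H : Heap G) :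
    ∃ (α : V → ℕ) (o : AcyclicOrientation (clanGraph G α)), H = mk o := by
  obtain ⟨α, q⟩ := H
  obtain ⟨o, rfl⟩ := Quotient.exists_rep q
  exact ⟨α, o, rfl⟩

end Heap

end Realization

/-! ### Heaps as commutation classes of words -/

section Words

variable {V : Type*} [LinearOrder V] {G : SimpleGraph V} {α α' : V → ℕ}

/-- Pieces are matched by label and occurrence number. An edge joins dependent labels and its
direction is the order in the list, which the common projection to these two labels determines. -/
theorem Heap.mk_eq_of_traceEquiv {o : AcyclicOrientation (clanGraph G α)}
    {o' : AcyclicOrientation (clanGraph G α')} {l : List (Piece α)} {l' : List (Piece α')}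
    (h : Realizes o l) (h' : Realizes o' l')
    (ht : TraceEquiv G (l.map Sigma.fst) (l'.map Sigma.fst)) : mk o = mk o' := by
  have key : ∀ {α : V → ℕ} {o : AcyclicOrientation (clanGraph G α)} {l : List (Piece α)},
      Realizes o l → ∃ f : Piece α → V × ℕ, l.map f = number (l.map Sigma.fst) ∧
        (∀ a, (f a).1 = a.1) ∧ Function.Injective f ∧
        (∀ x, (∃ a, f a = x) ↔ x.2 < (l.map Sigma.fst).count x.1) ∧
        ∀ a b, o.rel a b ↔ (clanGraph G α).Adj a b ∧
          [f a, f b].Sublist (number (l.map Sigma.fst)) := by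
    intro α o l h
    obtain ⟨f, hf⟩ := exists_map_eq_number Sigma.fst h.nodup
    have hnd : (l.map f).Nodup := hf ▸ nodup_number _
    refine ⟨f, hf, fun a => ?_, fun a b hab => ?_, fun x => ?_, fun a b => ?_⟩
    · have := congrArg (List.map Prod.fst) hf
      rw [map_fst_number, List.map_map] at this
      exact List.map_inj_left.1 this a (h.mem a)
    · exact List.inj_on_of_nodup_map hnd (h.mem a) (h.mem b) hab
    · rw [← mem_number, ← hf, List.mem_map]
      exact ⟨fun ⟨a, ha⟩ => ⟨a, h.mem a, ha⟩, fun ⟨a, _, ha⟩ => ⟨a, ha⟩⟩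
    · rw [h.rel_iff, ← hf]
      exact and_congr_right fun hadj =>
        (pair_sublist_map_iff hnd (h.mem a) (h.mem b) hadj.1).symm
  obtain ⟨f, -, hf1, hfi, hf2, hf3⟩ := key h
  obtain ⟨f', -, hf1', hfi', hf2', hf3'⟩ := key h'
  have hrange : ∀ a, ∃ a', f' a' = f a := fun a => by
    rw [hf2', ← ht.perm.count_eq]
    exact (hf2 _).1 ⟨a, rfl⟩
  have hrange' : ∀ a', ∃ a, f a = f' a' := fun a => by
    rw [hf2, ht.perm.count_eq]
    exact (hf2' _).1 ⟨a, rfl⟩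
  choose e he using hrange
  have hbij : Function.Bijective e := by
    refine ⟨fun a b hab => hfi ?_, fun a' => ?_⟩
    · rw [← he, ← he, hab]
    · obtain ⟨a, ha⟩ := hrange' a'
      exact ⟨a, hfi' ((he a).trans ha)⟩
  have hfst : ∀ a, (e a).1 = a.1 := fun a => by rw [← hf1', he, hf1]
  refine mk_eq_of_equiv (Equiv.ofBijective e hbij) hfst fun a b => ?_
  simp only [Equiv.ofBijective_apply]
  rw [hf3, hf3', he, he]
  have hadj : (clanGraph G α').Adj (e a) (e b) ↔ (clanGraph G α).Adj a b := by
    simp only [clanGraph, hfst, ne_eq, hbij.1.eq_iff]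
  rw [hadj]
  refine and_congr_right fun hab => ?_
  have hd : Dep G a.1 b.1 := hab.2
  have hp := ht a.1 b.1 hd
  rw [← pair_sublist_filter_iff (p := fun x : V × ℕ => decide (x.1 = a.1 ∨ x.1 = b.1))
      (by simp [hf1]) (by simp [hf1]),
    ← pair_sublist_filter_iff (l := number (l.map _))
      (p := fun x : V × ℕ => decide (x.1 = a.1 ∨ x.1 = b.1)) (by simp [hf1]) (by simp [hf1])]
  have e1 := filter_number (fun c => decide (c = a.1 ∨ c = b.1)) (l.map Sigma.fst)
  have e2 := filter_number (fun c => decide (c = a.1 ∨ c = b.1)) (l'.map Sigma.fst)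
  rw [e1, e2, hp]

/-- Pieces over two dependent vertices are pairwise adjacent, so the orientation orders them totally
and both lists show them in the same order. -/
theorem Realizes.traceEquiv {o : AcyclicOrientation (clanGraph G α)} {l l' : List (Piece α)}
    (h : Realizes o l) (h' : Realizes o l') :
    TraceEquiv G (l.map Sigma.fst) (l'.map Sigma.fst) := by
  intro a b hab
  rw [List.filter_map, List.filter_map]
  congr 1
  refine List.Perm.eq_of_pairwise (le := fun x y => ¬ o.rel y x) ?_ (h.pairwise.filter _)
    (h'.pairwise.filter _) ?_
  · intro x y hx hy hxy hyx
    by_contra hne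
    simp only [List.mem_filter, Function.comp_apply, decide_eq_true_eq] at hx hy
    have hadj : (clanGraph G α).Adj x y := by
      refine ⟨hne, ?_⟩
      rcases hx.2 with hx | hx <;> rcases hy.2 with hy | hy <;> rw [hx, hy]
      · exact Dep.refl _
      · exact hab
      · exact hab.symm
      · exact Dep.refl _
    exact ((o.adj_iff x y).1 hadj).elim hyx hxy
  · exact ((List.perm_ext_iff_of_nodup h.nodup h'.nodup).2
      fun a => iff_of_true (h.mem a) (h'.mem a)).filter _

/-- The pieces are the positions of the word, with edges directed from left to right. -/
theorem exists_realizes_word (G : SimpleGraph V) (w : List V) :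
    ∃ (α : V → ℕ) (o : AcyclicOrientation (clanGraph G α)) (l : List (Piece α)),
      Realizes o l ∧ l.map Sigma.fst = w := by
  let α : V → ℕ := fun v => Fintype.card {i : Fin w.length // w.get i = v}
  let e : Fin w.length ≃ Piece α :=
    (Equiv.sigmaFiberEquiv w.get).symm.trans
      (Equiv.sigmaCongrRight fun v => Fintype.equivFin {i : Fin w.length // w.get i = v})
  have he : ∀ i, (e i).1 = w.get i := fun i => rfl
  let o : AcyclicOrientation (clanGraph G α) :=
    { rel := fun a b => (clanGraph G α).Adj a b ∧ e.symm a < e.symm b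
      adj_iff := fun a b => by
        constructor
        · intro h
          rcases lt_or_gt_of_ne (e.symm.injective.ne h.1) with h' | h'
          · exact Or.inl ⟨h, h'⟩
          · exact Or.inr ⟨h.symm, h'⟩
        · rintro (h | h)
          · exact h.1
          · exact h.1.symm
      acyclic := fun a h => by
        have : ∀ b c, Relation.TransGen (fun a b => (clanGraph G α).Adj a b ∧
            e.symm a < e.symm b) b c → e.symm b < e.symm c := by
          intro b c h
          induction h with
          | single h => exact h.2
          | tail _ h ih => exact ih.trans h.2
        exact (this a a h).false }
  refine ⟨α, o, (List.finRange w.length).map e, ⟨?_, fun a => ?_, ?_⟩, ?_⟩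
  · exact (List.nodup_finRange _).map e.injective
  · exact List.mem_map.2 ⟨e.symm a, List.mem_finRange _, by simp⟩
  · rw [List.pairwise_map]
    refine (List.pairwise_lt_finRange _).imp fun {i j} hij h => ?_
    have := h.2
    simp only [Equiv.symm_apply_apply] at this
    exact absurd hij (not_lt.2 this.le)
  · rw [List.map_map]
    conv_rhs => rw [← List.map_get_finRange w]
    exact List.map_congr_left fun i _ => he i

end Words


/-! ### Rotating an acyclic orientation at a piece -/

namespace AcyclicOrientation

variable {P : Type*} {K : SimpleGraph P} {o : AcyclicOrientation K} {p : P}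

theorem rotateAt_eq_self (h : ∀ q, o.Reach p q) : o.rotateAt p = o := by
  ext a b
  simp [rotateAt, h]

theorem iterate_rotateAt_succ (h : ∀ q, (o.rotateAt p).Reach p q) (n : ℕ) :
    (fun o' => o'.rotateAt p)^[n + 1] o = o.rotateAt p := by
  rw [Function.iterate_succ_apply]
  exact Function.iterate_fixed (rotateAt_eq_self h) n

theorem isSource_iff_of_reach (h : ∀ q, o.Reach p q) (q : P) : o.IsSource q ↔ q = p := by
  constructor
  · intro hq
    rcases (Relation.ReflTransGen.cases_tail (h q)) with h' | ⟨r, -, hr⟩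
    · exact h'
    · exact absurd hr (hq r)
  · rintro rfl r hr
    exact o.acyclic q (Relation.TransGen.tail' (h r) hr)

theorem reach_of_unique_source [Finite P] (h : ∀ q, o.IsSource q → q = p) (q : P) :
    o.Reach p q := by
  induction q using o.wellFounded_transGen.induction with
  | _ q ih =>
    by_cases hq : o.IsSource q
    · rw [h q hq]; exact .refl
    · simp only [IsSource, not_forall, not_not] at hq
      obtain ⟨r, hr⟩ := hq
      exact (ih r (.single hr)).tail hr

theorem reach_rotateAt {q : P} (h : o.Reach p q) : (o.rotateAt p).Reach p q := by
  induction h with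
  | refl => exact .refl
  | tail hb hbc ih => exact ih.tail (Or.inl ⟨iff_of_true hb (hb.tail hbc), hbc⟩)

/-- On a connected graph, rotating repeatedly at `p` makes everything reachable from `p`. -/
theorem exists_iterate_rotateAt_reach [Finite P] (o : AcyclicOrientation K)
    (hconn : ∀ S : Set P, p ∈ S → (∀ a ∈ S, ∀ b, K.Adj a b → b ∈ S) → S = Set.univ) :
    ∃ n, ∀ q, ((fun o' => o'.rotateAt p)^[n] o).Reach p q := by
  induction hc : {q | ¬ o.Reach p q}.ncard using Nat.strong_induction_on generalizing o with
  | _ m ih =>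
    by_cases hall : ∀ q, o.Reach p q
    · exact ⟨0, hall⟩
    have hex : ∃ a, o.Reach p a ∧ ∃ b, K.Adj a b ∧ ¬ o.Reach p b := by
      by_contra hne
      push Not at hne
      have := hconn {q | o.Reach p q} .refl hne
      exact hall fun q => (this ▸ Set.mem_univ q : q ∈ {q | o.Reach p q})
    obtain ⟨a, ha, b, hab, hb⟩ := hex
    -- An edge leaving the reachable set points into it; the rotation reverses it and makes $b$
    -- reachable, while reachable pieces stay so. The unreachable set shrinks strictly.
    have hba : o.rel b a := ((o.adj_iff a b).1 hab).resolve_left fun h => hb (ha.tail h)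
    have hb' : (o.rotateAt p).Reach p b := (reach_rotateAt ha).tail (Or.inr ⟨by tauto, hba⟩)
    obtain ⟨n, hn⟩ := ih _ (by
      rw [← hc]
      refine Set.ncard_lt_ncard ((Set.ssubset_iff_of_subset ?_).2 ⟨b, hb, fun h => h hb'⟩)
      exact fun q hq h => hq (reach_rotateAt h)) (o.rotateAt p) rfl
    exact ⟨n + 1, hn⟩

theorem connected_of_reach {r : P} (h : ∀ q, o.Reach r q) (S : Set P) (hp : p ∈ S)
    (hS : ∀ a ∈ S, ∀ b, K.Adj a b → b ∈ S) : S = Set.univ := by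
  have hr : r ∈ S := by
    have hrp := h p
    clear h
    induction hrp using Relation.ReflTransGen.head_induction_on with
    | refl => exact hp
    | head hab _ ih => exact hS _ ih _ ((o.adj_iff _ _).2 (Or.inr hab))
  refine Set.eq_univ_of_forall fun q => ?_
  have := h q
  induction this with
  | refl => exact hr
  | tail _ hbc ih => exact hS _ ih _ ((o.adj_iff _ _).2 (Or.inl hbc))

end AcyclicOrientation

/-! ### Lyndon heaps are the heaps of standard Lyndon words -/

section Words

variable {V : Type*} {G : SimpleGraph V} {α : V → ℕ}

theorem Realizes.eq_cons {o : AcyclicOrientation (clanGraph G α)} {l : List (Piece α)}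
    (h : Realizes o l) {p : Piece α} (hp : ∀ q, o.IsSource q → q = p) : ∃ t, l = p :: t := by
  cases l with
  | nil => simpa using h.mem p
  | cons a t =>
    refine ⟨t, ?_⟩
    rw [hp a fun q hq => ?_]
    rcases List.mem_cons.1 (h.mem q) with rfl | hqt
    · exact o.irrefl _ hq
    · exact (List.pairwise_cons.1 h.pairwise).1 q hqt hq

namespace Heap

theorem words_nonempty [Fintype V] (H : Heap G) : H.words.Nonempty := by
  obtain ⟨α, o, rfl⟩ := H.exists_mk
  obtain ⟨l, hl⟩ := exists_realizes o
  exact ⟨_, mem_words_mk.2 ⟨l, hl, rfl⟩⟩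

variable {H H' : Heap G} {w w' : List V}

theorem count_of_mem_words [DecidableEq V] (hw : w ∈ H.words) (v : V) : w.count v = H.1 v := by
  obtain ⟨α, o, rfl⟩ := H.exists_mk
  obtain ⟨l, hl, rfl⟩ := mem_words_mk.1 hw
  exact hl.count_map_fst v

theorem uses_iff_of_mem_words (hw : w ∈ H.words) (v : V) : H.Uses v ↔ v ∈ w := by
  classical
  rw [Uses, ← count_of_mem_words hw, List.count_pos_iff]

theorem size_of_mem_words [Fintype V] (hw : w ∈ H.words) : H.size = w.length := by
  classical
  simp only [size, ← count_of_mem_words hw]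
  simpa using Multiset.sum_count_eq_card (s := Finset.univ) (m := (w : Multiset V)) (by simp)

end Heap

variable {V : Type*} [LinearOrder V] {G : SimpleGraph V} {α : V → ℕ}

namespace Heap

variable {H H' : Heap G} {w w' : List V}

theorem traceEquiv_of_mem_words (hw : w ∈ H.words) (hw' : w' ∈ H.words) : TraceEquiv G w w' := by
  obtain ⟨α, o, rfl⟩ := H.exists_mk
  obtain ⟨l, hl, rfl⟩ := mem_words_mk.1 hw
  obtain ⟨l', hl', rfl⟩ := mem_words_mk.1 hw'
  exact hl.traceEquiv hl'

theorem eq_of_traceEquiv (hw : w ∈ H.words) (hw' : w' ∈ H'.words) (h : TraceEquiv G w w') :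
    H = H' := by
  obtain ⟨α, o, rfl⟩ := H.exists_mk
  obtain ⟨α', o', rfl⟩ := H'.exists_mk
  obtain ⟨l, hl, rfl⟩ := mem_words_mk.1 hw
  obtain ⟨l', hl', rfl⟩ := mem_words_mk.1 hw'
  exact mk_eq_of_traceEquiv hl hl' h

theorem exists_mem_words (G : SimpleGraph V) (w : List V) : ∃ H : Heap G, w ∈ H.words := by
  obtain ⟨α, o, l, hl, rfl⟩ := exists_realizes_word G w
  exact ⟨mk o, mem_words_mk.2 ⟨l, hl, rfl⟩⟩

theorem mem_words_of_traceEquiv (hw : w ∈ H.words) (h : TraceEquiv G w w') : w' ∈ H.words := by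
  obtain ⟨H', hw'⟩ := exists_mem_words G w'
  rwa [eq_of_traceEquiv hw hw' h]

theorem isStandardWord_iff : H.IsStandardWord w ↔ w ∈ H.words ∧ IsStd G w := by
  refine ⟨fun h => ⟨h.1, .of_forall_le fun w' hw' => h.2 (mem_words_of_traceEquiv h.1 hw')⟩,
    fun h => ⟨h.1, fun w' hw' => h.2.le (traceEquiv_of_mem_words h.1 hw')⟩⟩

theorem exists_isStd_mem_words [Fintype V] (H : Heap G) : ∃ w ∈ H.words, IsStd G w := by
  obtain ⟨w, hw⟩ := H.words_nonempty
  exact ⟨_, mem_words_of_traceEquiv hw (traceEquiv_stdForm w), isStd_stdForm w⟩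

theorem stdLE_iff (hw : w ∈ H.words) (hs : IsStd G w) (hw' : w' ∈ H'.words) (hs' : IsStd G w') :
    H.StdLE H' ↔ w ≤ w' := by
  refine ⟨?_, fun h => ⟨w, w', isStandardWord_iff.2 ⟨hw, hs⟩, isStandardWord_iff.2 ⟨hw', hs'⟩, h⟩⟩
  rintro ⟨z, z', hz, hz', h⟩
  rw [isStandardWord_iff] at hz hz'
  rwa [hs.eq hz.2 (traceEquiv_of_mem_words hw hz.1),
    hs'.eq hz'.2 (traceEquiv_of_mem_words hw' hz'.1)]

end Heap

/-- In a heap with a word `u v` such that `v` is standard and starts at the piece `p` with its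
smallest letter, `v` consists of the pieces reachable from `p`. -/
theorem Realizes.reach_iff {o : AcyclicOrientation (clanGraph G α)} {l₁ l₂ : List (Piece α)}
    {p : Piece α} (h : Realizes o (l₁ ++ p :: l₂)) (hs : IsStd G ((p :: l₂).map Sigma.fst))
    (hp : ∀ a ∈ p :: l₂, p.1 ≤ a.1) (q : Piece α) : o.Reach p q ↔ q ∈ p :: l₂ := by
  constructor
  · intro hq
    induction hq with
    | refl => simp
    | @tail b c _ hbc ih =>
      refine (List.mem_append.1 (h.mem c)).resolve_left fun hc => ?_
      have h1 : [c, b].Sublist (l₁ ++ p :: l₂) :=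
        (List.singleton_sublist.2 hc).append (List.singleton_sublist.2 ih)
      exact pair_sublist_asymm h.nodup ((h.rel_iff b c).1 hbc).2 h1
  · suffices H : ∀ x y, p :: l₂ = x ++ y → ∀ q ∈ x, o.Reach p q from H _ [] (by simp) q
    intro x
    induction x using List.reverseRecOn with
    | nil => simp
    | append_singleton x r ih =>
      intro y hy q hq
      have hy' : p :: l₂ = x ++ r :: y := by simpa using hy
      have ih' := ih (r :: y) hy'
      rcases List.mem_append.1 hq with hq | hq
      · exact ih' q hq
      obtain rfl : q = r := by simpa using hq
      cases x with
      | nil =>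
        obtain rfl : p = q := by simp at hy'; exact hy'.1
        exact .refl
      | cons p' x =>
        rw [List.cons_append, List.cons.injEq] at hy'
        obtain ⟨rfl, rfl⟩ := hy'
        rw [List.map_cons, List.map_append, List.map_cons] at hs
        -- Some earlier piece of the list depends on $q$; it is reachable by induction, and the edge
        -- from it leads to $q$.
        obtain ⟨c, hc, hd⟩ := IsStd.exists_dep_of_head_le (x := x.map Sigma.fst) hs (hp q (by simp))
        rw [← List.map_cons, List.mem_map] at hc
        obtain ⟨a, ha, rfl⟩ := hc
        have hsub : [a, q].Sublist (l₁ ++ p :: (x ++ q :: y)) := by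
          refine List.Sublist.trans ?_ (List.sublist_append_right _ _)
          rw [← List.cons_append]
          exact (List.singleton_sublist.2 ha).append (List.singleton_sublist.2 (by simp))
        have hne : a ≠ q := by
          rintro rfl
          have := h.nodup.sublist hsub
          simp at this
        exact (ih' a ha).tail ((h.rel_iff a q).2 ⟨⟨hne, hd⟩, hsub⟩)

/-- The operation `A_p` on a heap with word `u v` as in `Realizes.reach_iff` gives the heap with
word `v u`. -/
theorem Realizes.rotateAt {o : AcyclicOrientation (clanGraph G α)} {l₁ l₂ : List (Piece α)}
    {p : Piece α} (h : Realizes o (l₁ ++ p :: l₂)) (hs : IsStd G ((p :: l₂).map Sigma.fst))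
    (hp : ∀ a ∈ p :: l₂, p.1 ≤ a.1) : Realizes (o.rotateAt p) (p :: l₂ ++ l₁) := by
  have hr := h.reach_iff hs hp
  have hpw := List.pairwise_append.1 h.pairwise
  have hnd := List.nodup_append.1 h.nodup
  have hmem : ∀ a ∈ l₁, a ∉ p :: l₂ := fun a ha ha' => hnd.2.2 a ha a ha' rfl
  refine ⟨List.nodup_append_comm.1 h.nodup, fun a => ?_, List.pairwise_append.2 ⟨?_, ?_, ?_⟩⟩
  · exact (List.mem_append.1 (h.mem a)).elim (List.mem_append_right _) (List.mem_append_left _)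
  · refine hpw.2.1.imp_of_mem fun {a b} ha hb hab => ?_
    simp only [AcyclicOrientation.rotateAt, hr, ha, hb]
    simpa using hab
  · refine hpw.1.imp_of_mem fun {a b} ha hb hab => ?_
    simp only [AcyclicOrientation.rotateAt, hr, hmem a ha, hmem b hb]
    simpa using hab
  · intro a ha b hb
    simp only [AcyclicOrientation.rotateAt, hr, ha, hmem b hb]
    simpa using hpw.2.2 b hb a ha

/-- Both halves are standard as factors of a standard word, and the half moved to the end, if
nonempty, starts with the smallest letter; so `IsStd.append` applies. -/
theorem Realizes.isStd_rotate {o : AcyclicOrientation (clanGraph G α)} {l₁ l₂ : List (Piece α)}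
    {p : Piece α} (h : Realizes o (l₁ ++ p :: l₂))
    (hs : IsStd G ((l₁ ++ p :: l₂).map Sigma.fst)) (hp : ∀ a : Piece α, p.1 ≤ a.1)
    (hd : ∀ c t, l₁ = c :: t → c.1 = p.1) : IsStd G ((p :: l₂ ++ l₁).map Sigma.fst) := by
  rw [List.map_append] at hs ⊢
  cases l₁ with
  | nil => simpa using hs
  | cons c t =>
    rw [List.map_cons (l := t)]
    have hc := hd c t rfl
    refine hs.of_append_right.append hs.of_append_left fun b hb => ?_
    rw [← List.map_cons, ← List.map_append, List.mem_map] at hb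
    obtain ⟨a, -, rfl⟩ := hb
    exact hc ▸ hp a

namespace Heap

variable [Fintype V] {H : Heap G} {w : List V}

/-- The first letter of $w$ is smallest, so all pieces are reachable from the first one. If the heap
were a power, $w$ would be a proper power. A rotation at a piece with the smallest letter has
standard word $vu$ where $w=uv$; any other rotation begins with a larger letter. -/
theorem isLyndon_of_isLyndonWord (hw : w ∈ H.words) (hs : IsStd G w) (hl : IsLyndonWord w) :
    H.IsLyndon := by
  obtain ⟨α, o, rfl⟩ := H.exists_mk
  obtain ⟨l, hr, rfl⟩ := mem_words_mk.1 hw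
  obtain ⟨p₀, t, rfl⟩ : ∃ p t, l = p :: t := List.exists_cons_of_ne_nil (by
    rintro rfl; exact hl.1 rfl)
  have hmin : ∀ a : Piece α, p₀.1 ≤ a.1 := fun a =>
    hl.head_le _ (by rw [← List.map_cons]; exact List.mem_map_of_mem (hr.mem a))
  have hreach : ∀ q, o.Reach p₀ q := fun q =>
    (Realizes.reach_iff (l₁ := []) hr hs (fun a _ => hmin a) q).2 (hr.mem q)
  have hsrc := AcyclicOrientation.isSource_iff_of_reach hreach
  refine ⟨⟨α, o, rfl, p₀, (hsrc p₀).2 rfl, fun q hq => (hsrc q).1 hq⟩, ?_, ?_⟩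
  · rintro ⟨K, k, hk, u, -, hu⟩
    have hpow : ∀ j, TraceEquiv G (List.replicate j u).flatten
        (List.replicate j (stdForm G u)).flatten := by
      intro j
      induction j with
      | zero => exact TraceEquiv.refl _
      | succ j ih =>
        simp only [List.replicate_succ, List.flatten_cons]
        exact (traceEquiv_stdForm u).append ih
    have hu' := mem_words_of_traceEquiv hu (hpow k)
    have ht := traceEquiv_of_mem_words hu' hw
    have hne : stdForm G u ≠ [] := by
      intro h
      have := ht.perm.length_eq
      rw [h] at this
      simp at this
    obtain ⟨f, y, hfy⟩ := List.exists_cons_of_ne_nil hne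
    have hstd := isStd_stdForm (G := G) u
    rw [hfy] at ht hu' hstd
    obtain ⟨k, rfl⟩ : ∃ j, k = j + 1 := ⟨k - 1, by omega⟩
    -- Every word of a pyramid starts at its source, so the standard word of the root starts with
    -- the smallest letter and its powers are standard.
    have hf : f = p₀.1 := by
      obtain ⟨l', hr', hl'⟩ := mem_words_mk.1 hu'
      obtain ⟨t', rfl⟩ := hr'.eq_cons fun q hq => (hsrc q).1 hq
      simp [List.replicate_succ] at hl'
      exact hl'.1
    have hfle : ∀ b ∈ f :: y, f ≤ b := by
      intro b hb
      rw [hf]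
      refine hl.head_le b ?_
      rw [← List.map_cons, ← ht.perm.mem_iff]
      exact List.mem_flatten.2 ⟨f :: y, by simp, hb⟩
    have heq := (hstd.flatten_replicate hfle (k + 1)).eq hs ht
    have h1 := hl.2 (List.replicate k (f :: y)).flatten (f :: y)
      (by rw [← heq, List.replicate_succ']; simp) (by
        obtain ⟨j, rfl⟩ : ∃ j, k = j + 1 := ⟨k - 1, by omega⟩
        simp [List.replicate_succ]) (by simp)
    rw [← heq, List.replicate_succ, List.flatten_cons] at h1
    exact absurd h1 (not_lt.2 (le_append_right_self _ _))
  · rintro H' ⟨α', o', p, n, hH, rfl, hsp⟩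
    obtain ⟨l', hr', hl'⟩ := mem_words_mk.1 (hH ▸ hw)
    obtain ⟨w', hw', hs'⟩ := exists_isStd_mem_words (mk ((fun o' => o'.rotateAt p)^[n] o'))
    rw [stdLE_iff hw hs hw' hs']
    have hmin' : ∀ a : Piece α', p₀.1 ≤ a.1 := fun a =>
      hl.head_le _ (by rw [← List.map_cons, hl']; exact List.mem_map_of_mem (hr'.mem a))
    rcases (hmin' p).eq_or_lt with hp | hp
    · obtain ⟨l₁, l₂, rfl⟩ := List.append_of_mem (hr'.mem p)
      rw [hl'] at hs hl
      have hd : ∀ c t, l₁ = c :: t → c.1 = p.1 := by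
        rintro c t rfl
        simp at hl'
        rw [← hl'.1, hp]
      have hsv : IsStd G ((p :: l₂).map Sigma.fst) := by
        rw [List.map_append] at hs
        exact hs.of_append_right
      cases n with
      | zero =>
        rw [Function.iterate_zero_apply] at hw'
        have := hs.eq hs' (traceEquiv_of_mem_words (hl' ▸ hH ▸ hw) hw')
        rw [hl', this]
      -- One application of $A_p$ already reaches the pyramid; further ones change nothing.
      | succ n =>
        have hrot := hr'.rotateAt hsv (fun a _ => hp ▸ hmin' a)
        have hsrot := hr'.isStd_rotate hs (fun a => hp ▸ hmin' a) hd
        have hall : ∀ q, (o'.rotateAt p).Reach p q := fun q =>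
          (Realizes.reach_iff (l₁ := []) hrot hsrot (fun a _ => hp ▸ hmin' a) q).2 (hrot.mem q)
        rw [AcyclicOrientation.iterate_rotateAt_succ hall] at hw'
        have hww := hs'.eq hsrot (traceEquiv_of_mem_words hw' (mem_words_mk.2 ⟨_, hrot, rfl⟩))
        rw [hww, hl', List.map_append, List.map_append]
        refine le_trans ?_ (le_append_right_self _ _)
        rw [List.map_append] at hl
        rcases eq_or_ne (l₁.map Sigma.fst) [] with h | h
        · rw [h]; exact le_rfl
        · exact (hl.2 _ _ rfl h (by simp)).le
    · obtain ⟨l'', hr'', rfl⟩ := mem_words_mk.1 hw'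
      obtain ⟨t', rfl⟩ := hr''.eq_cons fun q hq => (hsp q).1 hq
      exact (List.cons_lt_cons_iff.2 (Or.inl hp)).le

/-- Minimality is used twice: against the rotations to arbitrary pieces it makes the source label
smallest, and against single rotations at copies of that label it compares $w=uv$ with $vu$.
Aperiodicity makes $w$ primitive. -/
theorem isLyndonWord_of_isLyndon (hw : w ∈ H.words) (hs : IsStd G w) (hl : H.IsLyndon) :
    IsLyndonWord w := by
  obtain ⟨⟨α, o, rfl, r, hr1, hr2⟩, hap, hmin⟩ := hl
  obtain ⟨l, hr, rfl⟩ := mem_words_mk.1 hw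
  have hreach : ∀ q, o.Reach r q := AcyclicOrientation.reach_of_unique_source hr2
  obtain ⟨t, rfl⟩ := hr.eq_cons hr2
  -- A pyramid is connected, so it can be rotated to have any given piece as unique source, and the
  -- standard word then starts with the label of that piece.
  have hle : ∀ a : Piece α, r.1 ≤ a.1 := by
    intro p
    obtain ⟨n, hn⟩ := AcyclicOrientation.exists_iterate_rotateAt_reach o
      (AcyclicOrientation.connected_of_reach (p := p) hreach)
    have hsrc := AcyclicOrientation.isSource_iff_of_reach hn
    obtain ⟨w', hw', hs'⟩ := exists_isStd_mem_words (mk ((fun o' => o'.rotateAt p)^[n] o))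
    have h := (stdLE_iff hw hs hw' hs').1 (hmin _ ⟨α, o, p, n, rfl, rfl, hsrc⟩)
    obtain ⟨l'', hr'', rfl⟩ := mem_words_mk.1 hw'
    obtain ⟨t', rfl⟩ := hr''.eq_cons fun q hq => (hsrc q).1 hq
    rcases h.eq_or_lt with h | h
    · simp at h; exact h.1.le
    · exact List.head_le_of_lt h
  rw [List.map_cons]
  refine isLyndonWord_of_le_rotations ?_ ?_ ?_
  · intro b hb
    rw [← List.map_cons, List.mem_map] at hb
    obtain ⟨a, -, rfl⟩ := hb
    exact hle a
  · intro u v huv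
    rw [← List.map_cons, List.map_eq_append_iff] at huv
    obtain ⟨l₁, l₃, hl, rfl, hl₃⟩ := huv
    rw [List.map_eq_cons_iff] at hl₃
    obtain ⟨p, l₂, rfl, hp, rfl⟩ := hl₃
    rw [hl] at hr hs hw
    have hsv : IsStd G ((p :: l₂).map Sigma.fst) := by
      rw [List.map_append] at hs
      exact hs.of_append_right
    have hle' : ∀ a : Piece α, p.1 ≤ a.1 := fun a => hp ▸ hle a
    have hrot := hr.rotateAt hsv (fun a _ => hle' a)
    have hsrot := hr.isStd_rotate hs hle' (by
      rintro c s rfl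
      rw [List.cons_append, List.cons.injEq] at hl
      rw [hp, hl.1])
    have hall : ∀ q, (o.rotateAt p).Reach p q := fun q =>
      (Realizes.reach_iff (l₁ := []) hrot hsrot (fun a _ => hle' a) q).2 (hrot.mem q)
    have h := (stdLE_iff hw hs (mem_words_mk.2 ⟨_, hrot, rfl⟩) hsrot).1
      (hmin _ ⟨α, o, p, 1, rfl, rfl, AcyclicOrientation.isSource_iff_of_reach hall⟩)
    rw [← hl] at h
    simpa [hp] using h
  · intro x k hk hx
    obtain ⟨K, hK⟩ := exists_mem_words G x
    exact hap ⟨K, k, hk, x, hK, by rw [← hx]; exact hw⟩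

end Heap

end Words


/-! ### Inclusion–exclusion -/

section InclusionExclusion

open scoped Classical in
theorem card_forall_not_eq_sum {V X : Type*} [Fintype V] (K : Finset X) (r : X → V → Prop) :
    ((K.filter fun x => ∀ v, ¬ r x v).card : ℚ) =
      ∑ B : Finset V, (-1 : ℚ) ^ B.card * (K.filter fun x => ∀ v ∈ B, r x v).card := by
  have h1 : ∀ B : Finset V, (-1 : ℚ) ^ B.card * (K.filter fun x => ∀ v ∈ B, r x v).card =
      ∑ x ∈ K, if B ⊆ Finset.univ.filter (r x) then (-1 : ℚ) ^ B.card else 0 := by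
    intro B
    rw [← Finset.sum_filter, Finset.sum_const, nsmul_eq_mul, mul_comm]
    simp [Finset.subset_iff]
  rw [Finset.sum_congr rfl fun B _ => h1 B, Finset.sum_comm, Finset.card_filter, Nat.cast_sum]
  refine Finset.sum_congr rfl fun x _ => ?_
  have h2 : Finset.univ.filter (fun B => B ⊆ Finset.univ.filter (r x)) =
      (Finset.univ.filter (r x)).powerset := by ext; simp
  rw [← Finset.sum_filter, h2]
  have h3 := congrArg (Int.cast : ℤ → ℚ)
    (Finset.sum_powerset_neg_one_pow_card (x := Finset.univ.filter (r x)))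
  push_cast at h3
  rw [h3]
  by_cases h : ∀ v, ¬ r x v <;> simp [Finset.filter_eq_empty_iff, h]

end InclusionExclusion

/-! ### Products of one series over all variables -/

section Multi

open PowerSeries

/-- The product `∏ᵢ f(xᵢ)` for a power series `f` with constant coefficient `1`. -/
def multi (f : ℚ⟦X⟧) : MvPowerSeries ℕ+ ℚ := fun d => ∏ i ∈ d.support, coeff (d i) f

theorem coeff_multi (f : ℚ⟦X⟧) (d : ℕ+ →₀ ℕ) :
    MvPowerSeries.coeff d (multi f) = ∏ i ∈ d.support, coeff (d i) f := rfl

theorem coeff_multi_of_subset {f : ℚ⟦X⟧} (hf : coeff 0 f = 1) {d : ℕ+ →₀ ℕ} {s : Finset ℕ+}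
    (h : d.support ⊆ s) : MvPowerSeries.coeff d (multi f) = ∏ i ∈ s, coeff (d i) f := by
  rw [coeff_multi]
  refine Finset.prod_subset h fun i _ hi => ?_
  rw [Finsupp.notMem_support_iff.1 hi, hf]

theorem multi_one : multi 1 = 1 := by
  classical
  ext d
  rw [coeff_multi, MvPowerSeries.coeff_one]
  split_ifs with h
  · simp [h]
  · obtain ⟨i, hi⟩ := Finsupp.support_nonempty_iff.2 h
    refine Finset.prod_eq_zero hi ?_
    rw [coeff_one, if_neg (Finsupp.mem_support_iff.1 hi)]

/-- Splitting an exponent vector in two means splitting each exponent independently. Constant term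
$1$ lets variables outside the support of a summand be included. -/
theorem multi_mul {f g : ℚ⟦X⟧} (hf : coeff 0 f = 1) (hg : coeff 0 g = 1) :
    multi (f * g) = multi f * multi g := by
  classical
  ext d
  rw [coeff_multi, MvPowerSeries.coeff_mul]
  simp only [coeff_mul]
  rw [Finset.prod_sum]
  symm
  have hle : ∀ p ∈ Finset.HasAntidiagonal.antidiagonal d, p.1.support ⊆ d.support ∧ p.2.support ⊆ d.support := by
    intro p hp
    rw [Finset.HasAntidiagonal.mem_antidiagonal] at hp
    rw [← hp]
    exact ⟨Finsupp.support_mono le_self_add, Finsupp.support_mono le_add_self⟩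
  refine Finset.sum_bij (fun p _ i _ => (p.1 i, p.2 i)) ?_ ?_ ?_ ?_
  · intro p hp
    rw [Finset.HasAntidiagonal.mem_antidiagonal] at hp
    rw [Finset.mem_pi]
    intro i _
    rw [Finset.HasAntidiagonal.mem_antidiagonal, ← hp, Finsupp.add_apply]
  · intro p hp q hq h
    have key : ∀ i, p.1 i = q.1 i ∧ p.2 i = q.2 i := by
      intro i
      by_cases hi : i ∈ d.support
      · have := congrFun (congrFun h i) hi
        exact Prod.mk.injEq _ _ _ _ ▸ this
      · have h1 : ∀ e : ℕ+ →₀ ℕ, e.support ⊆ d.support → e i = 0 := fun e he =>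
          Finsupp.notMem_support_iff.1 fun h => hi (he h)
        simp [h1 _ (hle p hp).1, h1 _ (hle p hp).2, h1 _ (hle q hq).1, h1 _ (hle q hq).2]
    exact Prod.ext (Finsupp.ext fun i => (key i).1) (Finsupp.ext fun i => (key i).2)
  · intro q hq
    rw [Finset.mem_pi] at hq
    refine ⟨(Finsupp.onFinset d.support (fun i => if h : i ∈ d.support then (q i h).1 else 0)
      fun i hi => by by_contra h; simp [h] at hi,
      Finsupp.onFinset d.support (fun i => if h : i ∈ d.support then (q i h).2 else 0)
      fun i hi => by by_contra h; simp [h] at hi), ?_, ?_⟩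
    · rw [Finset.HasAntidiagonal.mem_antidiagonal]
      ext i
      by_cases hi : i ∈ d.support
      · have := hq i hi
        rw [Finset.HasAntidiagonal.mem_antidiagonal] at this
        simp only [Finsupp.add_apply, Finsupp.onFinset_apply, dif_pos hi, this]
      · simp only [Finsupp.add_apply, Finsupp.onFinset_apply, dif_neg hi]
        exact (Finsupp.notMem_support_iff.1 hi).symm
    · funext i hi
      simp only [Finsupp.onFinset_apply, dif_pos hi]
  · intro p hp
    rw [coeff_multi_of_subset hf (hle p hp).1, coeff_multi_of_subset hg (hle p hp).2,
      ← Finset.prod_mul_distrib, ← Finset.prod_attach]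

theorem coeff_zero_prod_eq_one {ι : Type*} (s : Finset ι) {f : ι → ℚ⟦X⟧}
    (hf : ∀ i ∈ s, coeff 0 (f i) = 1) : coeff 0 (∏ i ∈ s, f i) = 1 := by
  simp only [coeff_zero_eq_constantCoeff, map_prod] at hf ⊢
  exact Finset.prod_eq_one hf

theorem multi_prod {ι : Type*} (s : Finset ι) {f : ι → ℚ⟦X⟧}
    (hf : ∀ i ∈ s, coeff 0 (f i) = 1) : multi (∏ i ∈ s, f i) = ∏ i ∈ s, multi (f i) := by
  classical
  induction s using Finset.induction_on with
  | empty => simp [multi_one]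
  | insert a s ha ih =>
    have hs := fun i hi => hf i (Finset.mem_insert_of_mem hi)
    rw [Finset.prod_insert ha, Finset.prod_insert ha,
      multi_mul (hf a (Finset.mem_insert_self _ _)) (coeff_zero_prod_eq_one s hs), ih hs]

theorem divisibleSeries_eq_multi (n : ℕ) :
    divisibleSeries n = multi (mk fun m => if n ∣ m then 1 else 0) := by
  classical
  ext d
  rw [coeff_divisibleSeries, coeff_multi]
  simp only [coeff_mk, Finset.prod_ite_zero]
  have h : (∀ i, n ∣ d i) ↔ ∀ i ∈ d.support, n ∣ d i := by
    refine ⟨fun h i _ => h i, fun h i => ?_⟩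
    by_cases hi : i ∈ d.support
    · exact h i hi
    · simp [Finsupp.notMem_support_iff.1 hi]
  simp [h]

theorem one_sub_X_pow_mul_mk {n : ℕ} (hn : 0 < n) :
    ((1 : ℚ⟦X⟧) - X ^ n) * mk (fun m => if n ∣ m then 1 else 0) = 1 := by
  ext m
  rw [sub_mul, one_mul, map_sub, coeff_X_pow_mul', coeff_mk, coeff_mk, coeff_one]
  by_cases hle : n ≤ m
  · have : n ∣ m - n ↔ n ∣ m := ⟨fun h => by
      have := Nat.dvd_add h (dvd_refl n)
      rwa [Nat.sub_add_cancel hle] at this, fun h => Nat.dvd_sub h dvd_rfl⟩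
    simp [hle, this]
    omega
  · have : n ∣ m ↔ m = 0 := ⟨fun h => Nat.eq_zero_of_dvd_of_lt h (by omega), by rintro rfl; simp⟩
    simp [hle, this]

theorem coeff_zero_one_sub {n : ℕ} (hn : 0 < n) : coeff 0 ((1 : ℚ⟦X⟧) - (-X) ^ n) = 1 := by
  simp [hn.ne']

theorem multi_mul_divisibleSeries_of_even {n : ℕ} (hn : 0 < n) (he : Even n) :
    multi (1 - (-X) ^ n) * divisibleSeries n = 1 := by
  rw [divisibleSeries_eq_multi, ← multi_mul (coeff_zero_one_sub hn) (by simp), he.neg_pow,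
    one_sub_X_pow_mul_mk hn, multi_one]

/-- This is $1+x^n=(1-x^{2n})/(1-x^n)$ in each variable, the source of parts twice the size of an
odd heap. -/
theorem multi_mul_divisibleSeries_of_odd {n : ℕ} (ho : Odd n) :
    multi (1 - (-X) ^ n) * divisibleSeries (2 * n) = divisibleSeries n := by
  have hn : 0 < n := ho.pos
  rw [divisibleSeries_eq_multi, divisibleSeries_eq_multi,
    ← multi_mul (coeff_zero_one_sub hn) (by simp), ho.neg_pow]
  congr 1
  have h1 := one_sub_X_pow_mul_mk hn
  have h2 := one_sub_X_pow_mul_mk (n := 2 * n) (by omega)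
  rw [mul_comm 2 n, pow_mul] at h2
  rw [mul_comm 2 n]
  linear_combination (mk fun m => if n ∣ m then (1 : ℚ) else 0) * h2 -
    (1 + X ^ n) * (mk fun m => if n * 2 ∣ m then (1 : ℚ) else 0) * h1

end Multi

/-! ### Colorings as families of stable sets -/

section Kromatic

variable {V : Type*} [Fintype V]

theorem colorExponent_apply (κ : V → Finset ℕ+) (i : ℕ+) [DecidablePred fun v => i ∈ κ v] :
    colorExponent κ i = (Finset.univ.filter fun v => i ∈ κ v).card := by
  classical
  simp only [colorExponent, Finsupp.finsetSum_apply, Finsupp.single_apply, Finset.sum_ite_eq',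
    Finset.card_filter]
  congr!

theorem mem_support_of_mem {κ : V → Finset ℕ+} {i : ℕ+} {v : V} (h : i ∈ κ v) :
    i ∈ (colorExponent κ).support := by
  classical
  rw [Finsupp.mem_support_iff, colorExponent_apply]
  exact (Finset.card_pos.2 ⟨v, by simpa using h⟩).ne'

theorem finite_colorExponent_eq (d : ℕ+ →₀ ℕ) :
    {κ : V → Finset ℕ+ | colorExponent κ = d}.Finite := by
  classical
  refine Set.Finite.subset
    (Set.Finite.pi' (t := fun _ : V => (d.support.powerset : Set (Finset ℕ+)))
      fun _ => Finset.finite_toSet _) ?_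
  rintro κ rfl v
  simp only [Finset.coe_powerset, Set.mem_preimage, Set.mem_powerset_iff, Finset.coe_subset]
  exact fun i hi => mem_support_of_mem hi

open scoped Classical in
/-- The colorings with possibly empty color sets and a given exponent vector. -/
def colorings (G : SimpleGraph V) (d : ℕ+ →₀ ℕ) : Finset (V → Finset ℕ+) :=
  (finite_colorExponent_eq d).toFinset.filter fun κ => ∀ u v, G.Adj u v → Disjoint (κ u) (κ v)

theorem mem_colorings {G : SimpleGraph V} {d : ℕ+ →₀ ℕ} {κ : V → Finset ℕ+} :
    κ ∈ colorings G d ↔ colorExponent κ = d ∧ ∀ u v, G.Adj u v → Disjoint (κ u) (κ v) := by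
  simp [colorings]

variable [LinearOrder V]

open scoped Classical in
-- A coloring is transposed: each color $i$ is sent to the stable set of vertices carrying it, of
-- size $d_i$, and the choices for different colors are independent.
theorem card_colorings_filter (G : SimpleGraph V) (d : ℕ+ →₀ ℕ) (B : Finset V) :
    ((colorings G d).filter fun κ => ∀ v ∈ B, κ v = ∅).card =
      ∏ i ∈ d.support, ((stableSets G B).filter fun S => S.card = d i).card := by
  rw [← Finset.card_pi]
  refine Finset.card_bij (fun κ _ i _ => Finset.univ.filter fun v => i ∈ κ v) ?_ ?_ ?_
  · intro κ hκ
    rw [Finset.mem_filter, mem_colorings] at hκ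
    obtain ⟨⟨hd, hdis⟩, hB⟩ := hκ
    rw [Finset.mem_pi]
    intro i _
    rw [Finset.mem_filter, mem_stableSets, ← hd, colorExponent_apply]
    refine ⟨⟨fun a ha haB => ?_, fun a ha b hb hab => ?_⟩, rfl⟩
    · simp [hB a haB] at ha
    · simp only [Finset.mem_filter, Finset.mem_univ, true_and] at ha hb
      exact Finset.disjoint_left.1 (hdis a b hab) ha hb
  · intro κ hκ κ' hκ' h
    rw [Finset.mem_filter, mem_colorings] at hκ hκ'
    funext v
    ext i
    by_cases hi : i ∈ d.support
    · have := congrFun (congrFun h i) hi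
      simpa using (Finset.ext_iff.1 this) v
    · exact iff_of_false (fun h => hi (hκ.1.1 ▸ mem_support_of_mem h))
        (fun h => hi (hκ'.1.1 ▸ mem_support_of_mem h))
  · intro q hq
    rw [Finset.mem_pi] at hq
    simp only [Finset.mem_filter, mem_stableSets] at hq
    let κ : V → Finset ℕ+ := fun v => d.support.filter fun i => ∃ h : i ∈ d.support, v ∈ q i h
    have hκ : ∀ i (hi : i ∈ d.support) v, i ∈ κ v ↔ v ∈ q i hi := by
      intro i hi v
      simp only [κ, Finset.mem_filter]
      exact ⟨fun ⟨_, _, h⟩ => h, fun h => ⟨hi, hi, h⟩⟩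
    have hset : ∀ i (hi : i ∈ d.support), (Finset.univ.filter fun v => i ∈ κ v) = q i hi := by
      intro i hi
      ext v
      simp [hκ i hi]
    refine ⟨κ, ?_, ?_⟩
    · rw [Finset.mem_filter, mem_colorings]
      refine ⟨⟨?_, fun u v huv => ?_⟩, fun v hv => ?_⟩
      · ext i
        rw [colorExponent_apply]
        by_cases hi : i ∈ d.support
        · rw [hset i hi, (hq i hi).2]
        · rw [Finsupp.notMem_support_iff.1 hi, Finset.card_eq_zero, Finset.filter_eq_empty_iff]
          intro v _ h
          exact hi (Finset.mem_filter.1 h).1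
      · rw [Finset.disjoint_left]
        intro i hu hv
        have hi := (Finset.mem_filter.1 hu).1
        exact (hq i hi).1.2 u ((hκ i hi u).1 hu) v ((hκ i hi v).1 hv) huv
      · refine Finset.eq_empty_of_forall_notMem fun i h => ?_
        have hi := (Finset.mem_filter.1 h).1
        exact (hq i hi).1.1 v ((hκ i hi v).1 h) hv
    · funext i hi
      exact hset i hi

theorem coeff_kromatic (G : SimpleGraph V) (d : ℕ+ →₀ ℕ) :
    MvPowerSeries.coeff d (kromatic G) = ∑ B : Finset V, (-1 : ℚ) ^ B.card *
      ∏ i ∈ d.support, (((stableSets G B).filter fun S => S.card = d i).card : ℚ) := by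
  classical
  have h1 : MvPowerSeries.coeff d (kromatic G) =
      (((colorings G d).filter fun κ => ∀ v, ¬ κ v = ∅).card : ℚ) := by
    rw [MvPowerSeries.coeff_apply, kromatic, ← Set.ncard_coe_finset]
    congr 2
    ext κ
    simp only [IsProperSetColoring, Finset.coe_filter, mem_colorings, Set.mem_ofPred_eq,
      Finset.nonempty_iff_ne_empty, ne_eq]
    tauto
  have h2 := card_forall_not_eq_sum (colorings G d) fun κ v => κ v = ∅
  rw [h1]
  refine Eq.trans ?_ (h2.trans (Finset.sum_congr rfl fun B _ => ?_))
  · congr!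
  · have h3 := card_colorings_filter G d B
    rw [← Nat.cast_prod]
    congr 2
    convert h3

end Kromatic


/-! ### The contribution of a single Lyndon heap -/

section Factors

/-- The sign `∏ₖ ((-1) ^ (k + 1)) ^ eₖ` of a monomial. -/
def monomialSign (e : ℕ →₀ ℕ) : ℚ := (-1) ^ (e.sum fun k m => (k + 1) * m)

theorem monomialSign_zero : monomialSign 0 = 1 := by simp [monomialSign]

theorem monomialSign_add (e e' : ℕ →₀ ℕ) :
    monomialSign (e + e') = monomialSign e * monomialSign e' := by
  rw [monomialSign, Finsupp.sum_add_index' (by simp) (by intros; ring), pow_add]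
  rfl

theorem monomialSign_single (k : ℕ) : monomialSign (Finsupp.single k 1) = (-1) ^ (k + 1) := by
  simp [monomialSign]

theorem monomialSign_sum {ι : Type*} (s : Finset ι) (f : ι → ℕ →₀ ℕ) :
    monomialSign (∑ i ∈ s, f i) = ∏ i ∈ s, monomialSign (f i) := by
  classical
  induction s using Finset.induction_on with
  | empty => simp [monomialSign_zero]
  | insert a s ha ih => rw [Finset.sum_insert ha, Finset.prod_insert ha, monomialSign_add, ih]

/-- The multiplicities of parts that may be assigned to one Lyndon heap of size `n`. -/
def Allowed (n : ℕ) (e : ℕ →₀ ℕ) : Prop :=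
  (∀ k, e k ≠ 0 → n = k ∨ (k = 2 * n ∧ Odd n)) ∧ ∀ k, Odd k → e k ≤ 1

theorem allowed_zero (n : ℕ) : Allowed n 0 := by simp [Allowed]

theorem allowed_add_single_iff {n m : ℕ} (hm : n = m ∨ (m = 2 * n ∧ Odd n)) (he : Even m)
    (e : ℕ →₀ ℕ) : Allowed n (e + Finsupp.single m 1) ↔ Allowed n e := by
  have key : ∀ k, k ≠ m → (e + Finsupp.single m 1 : ℕ →₀ ℕ) k = e k := fun k hk => by simp [hk]
  refine and_congr (forall_congr' fun k => ?_) (forall_congr' fun k => ?_)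
  · by_cases hk : k = m
    · subst hk; simp [hm]
    · rw [key k hk]
  · by_cases hk : k = m
    · subst hk
      exact iff_of_true (fun h => absurd he (Nat.not_even_iff_odd.2 h))
        (fun h => absurd he (Nat.not_even_iff_odd.2 h))
    · rw [key k hk]

open scoped Classical in
/-- The generating series of the multiplicities of parts assigned to one Lyndon heap of
size `n`. -/
def factorSeries (n : ℕ) : MvPowerSeries ℕ ℚ :=
  fun e => if Allowed n e then monomialSign e else 0

open scoped Classical in
theorem coeff_factorSeries (n : ℕ) (e : ℕ →₀ ℕ) :
    MvPowerSeries.coeff e (factorSeries n) = if Allowed n e then monomialSign e else 0 := rfl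

open scoped Classical in
-- The even part $m$ may be repeated freely and carries sign $-1$, so the terms with multiplicities
-- $e'$ and $e'+\delta_m$ cancel whenever $m$ occurs in the monomial.
theorem coeff_factorSeries_mul {n m : ℕ} (hm : n = m ∨ (m = 2 * n ∧ Odd n)) (he : Even m)
    (e : ℕ →₀ ℕ) : MvPowerSeries.coeff e (factorSeries n * (1 + MvPowerSeries.X m)) =
      if e m = 0 ∧ Allowed n e then monomialSign e else 0 := by
  rw [mul_add, mul_one, map_add, MvPowerSeries.X, MvPowerSeries.coeff_mul_monomial, mul_one]
  by_cases h : e m = 0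
  · rw [if_neg (by rw [Finsupp.single_le_iff]; omega), add_zero, coeff_factorSeries]
    simp [h]
  · have hle : Finsupp.single m 1 ≤ e := by rw [Finsupp.single_le_iff]; omega
    rw [if_pos hle]
    obtain ⟨e', rfl⟩ : ∃ e', e = e' + Finsupp.single m 1 := ⟨_, (tsub_add_cancel_of_le hle).symm⟩
    have hne : ¬ ((e' + Finsupp.single m 1 : ℕ →₀ ℕ) m = 0 ∧
        Allowed n (e' + Finsupp.single m 1)) := fun h' => h h'.1
    rw [if_neg hne, add_tsub_cancel_right, coeff_factorSeries, coeff_factorSeries,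
      allowed_add_single_iff hm he, monomialSign_add, monomialSign_single, he.add_one.neg_one_pow]
    split_ifs <;> simp

theorem factorSeries_mul_of_even {n : ℕ} (he : Even n) :
    factorSeries n * (1 + MvPowerSeries.X n) = 1 := by
  classical
  ext e
  rw [coeff_factorSeries_mul (Or.inl rfl) he, MvPowerSeries.coeff_one]
  have h : (e n = 0 ∧ Allowed n e) ↔ e = 0 := by
    constructor
    · rintro ⟨h0, h1, -⟩
      ext k
      by_contra hk
      rcases h1 k hk with rfl | ⟨-, h⟩
      · exact hk h0
      · exact absurd he (Nat.not_even_iff_odd.2 h)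
    · rintro rfl
      exact ⟨rfl, allowed_zero n⟩
  simp only [h]
  split_ifs with h'
  · rw [h', monomialSign_zero]
  · rfl

theorem factorSeries_mul_of_odd {n : ℕ} (ho : Odd n) :
    factorSeries n * (1 + MvPowerSeries.X (2 * n)) = 1 + MvPowerSeries.X n := by
  classical
  have hn : n ≠ 0 := ho.pos.ne'
  ext e
  rw [coeff_factorSeries_mul (Or.inr ⟨rfl, ho⟩) (even_two_mul n), map_add,
    MvPowerSeries.coeff_one, MvPowerSeries.coeff_X]
  have hne : Finsupp.single n 1 ≠ (0 : ℕ →₀ ℕ) := by simp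
  have h : (e (2 * n) = 0 ∧ Allowed n e) ↔ e = 0 ∨ e = Finsupp.single n 1 := by
    constructor
    · rintro ⟨h0, h1, h2⟩
      have hk : ∀ k, k ≠ n → e k = 0 := by
        intro k hkn
        by_contra hk
        rcases h1 k hk with rfl | ⟨rfl, -⟩
        · exact hkn rfl
        · exact hk h0
      have := h2 n ho
      rcases Nat.le_one_iff_eq_zero_or_eq_one.1 this with h | h
      · left
        ext k
        by_cases hkn : k = n
        · subst hkn; simpa using h
        · simpa using hk k hkn
      · right
        ext k
        by_cases hkn : k = n
        · subst hkn; simpa using h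
        · simpa [hkn] using hk k hkn
    · rintro (rfl | rfl)
      · exact ⟨rfl, allowed_zero n⟩
      · refine ⟨Finsupp.single_eq_of_ne (by omega), fun k hk => Or.inl ?_, fun k _ => ?_⟩
        · by_contra h
          exact hk (Finsupp.single_eq_of_ne (Ne.symm h))
        · rw [Finsupp.single_apply]; split_ifs <;> simp
  simp only [h]
  by_cases h0 : e = 0
  · subst h0
    simp [monomialSign_zero, hne.symm]
  · by_cases h1 : e = Finsupp.single n 1
    · subst h1
      simp [monomialSign_single, ho.add_one.neg_one_pow]
    · simp [h0, h1]

end Factors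

/-! ### Families of Lyndon heaps and products of factors -/

section Coverings

variable {ι : Type*} (σ : ι → ℕ)

/-- The families of objects in `F` chosen for the parts with multiplicities `e`, with the
conditions on sizes and repetitions of `lyndonCoverings`. -/
def partChoices (F : Finset ι) (e : ℕ →₀ ℕ) : Set (Multiset (ℕ × ι)) :=
  {M | M.map Prod.fst = Finsupp.toMultiset e ∧
    (∀ x ∈ M, x.2 ∈ F ∧ (σ x.2 = x.1 ∨ (x.1 = 2 * σ x.2 ∧ Odd (σ x.2)))) ∧
    (M.filter fun x => Odd x.1).Nodup}

open scoped Classical in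
/-- The family with multiplicities `l i k` of the pair `(k, i)`. -/
def choiceOfMultiplicities (F : Finset ι) (l : ι →₀ ℕ →₀ ℕ) : Multiset (ℕ × ι) :=
  ∑ i ∈ F, (Finsupp.toMultiset (l i)).map fun k => (k, i)

open scoped Classical in
theorem count_choiceOfMultiplicities (F : Finset ι) (l : ι →₀ ℕ →₀ ℕ) (k : ℕ) (i : ι) :
    (choiceOfMultiplicities F l).count (k, i) = if i ∈ F then l i k else 0 := by
  rw [choiceOfMultiplicities, Multiset.count_sum']
  have h : ∀ j ∈ F, ((Finsupp.toMultiset (l j)).map fun k => (k, j)).count (k, i) =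
      if i = j then l i k else 0 := by
    intro j _
    split_ifs with hij
    · subst hij
      rw [Multiset.count_map_eq_count' _ _ (Prod.mk_left_injective i), Finsupp.count_toMultiset]
    · refine Multiset.count_eq_zero_of_notMem fun h => hij ?_
      obtain ⟨_, _, h⟩ := Multiset.mem_map.1 h
      exact (congrArg Prod.snd h).symm
  rw [Finset.sum_congr rfl h, Finset.sum_ite_eq]

theorem map_fst_choiceOfMultiplicities (F : Finset ι) (l : ι →₀ ℕ →₀ ℕ) :
    (choiceOfMultiplicities F l).map Prod.fst = Finsupp.toMultiset (∑ i ∈ F, l i) := by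
  rw [choiceOfMultiplicities, ← Multiset.coe_mapAddMonoidHom, map_sum, map_sum]
  refine Finset.sum_congr rfl fun i _ => ?_
  simp

variable {σ}

open scoped Classical in
-- Grouping the pairs by their second entry splits the multiplicities of parts among the objects,
-- and the conditions become conditions on each object separately.
theorem bijOn_choiceOfMultiplicities (F : Finset ι) (e : ℕ →₀ ℕ) :
    Set.BijOn (choiceOfMultiplicities F)
      ((F.finsuppAntidiag e).filter fun l => ∀ i ∈ F, Allowed (σ i) (l i)) (partChoices σ F e) := by
  refine ⟨fun l hl => ?_, fun l hl l' hl' h => ?_, fun M hM => ?_⟩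
  · rw [Finset.mem_coe, Finset.mem_filter, Finset.mem_finsuppAntidiag] at hl
    obtain ⟨⟨hsum, hsupp⟩, hall⟩ := hl
    refine ⟨by rw [map_fst_choiceOfMultiplicities, ← hsum], ?_, ?_⟩
    · rintro ⟨k, i⟩ hx
      rw [← Multiset.count_pos, count_choiceOfMultiplicities] at hx
      split_ifs at hx with hi
      · exact ⟨hi, (hall i hi).1 k hx.ne'⟩
      · exact absurd hx (lt_irrefl 0)
    · rw [Multiset.nodup_iff_count_le_one]
      rintro ⟨k, i⟩
      rw [Multiset.count_filter, count_choiceOfMultiplicities]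
      split_ifs with hk hi
      · exact (hall i hi).2 k hk
      all_goals simp
  · rw [Finset.mem_coe, Finset.mem_filter, Finset.mem_finsuppAntidiag] at hl hl'
    ext i k
    by_cases hi : i ∈ F
    · have := congrArg (Multiset.count (k, i)) h
      simpa [count_choiceOfMultiplicities, hi] using this
    · rw [Finsupp.notMem_support_iff.1 fun h => hi (hl.1.2 h),
        Finsupp.notMem_support_iff.1 fun h => hi (hl'.1.2 h)]
  · obtain ⟨h1, h2, h3⟩ := hM
    let l : ι →₀ ℕ →₀ ℕ := Finsupp.onFinset F
      (fun i => if i ∈ F then Multiset.toFinsupp ((M.filter fun x => x.2 = i).map Prod.fst) else 0)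
      (fun i hi => by by_contra h; simp [h] at hi)
    have hl : ∀ i ∈ F, ∀ k, l i k = M.count (k, i) := by
      intro i hi k
      simp only [l, Finsupp.onFinset_apply, if_pos hi, Multiset.toFinsupp_apply]
      rw [Multiset.count_map, Multiset.filter_filter, Multiset.count_eq_card_filter_eq]
      congr 1
      refine Multiset.filter_congr fun x _ => ?_
      rw [Prod.ext_iff, eq_comm (a := i)]
    have hM : choiceOfMultiplicities F l = M := by
      ext ⟨k, i⟩
      rw [count_choiceOfMultiplicities]
      split_ifs with hi
      · exact hl i hi k
      · exact (Multiset.count_eq_zero_of_notMem fun h => hi (h2 _ h).1).symm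
    refine ⟨l, ?_, hM⟩
    rw [Finset.mem_coe, Finset.mem_filter, Finset.mem_finsuppAntidiag]
    refine ⟨⟨?_, fun i hi => ?_⟩, fun i hi => ⟨fun k hk => ?_, fun k hk => ?_⟩⟩
    · rw [← hM, map_fst_choiceOfMultiplicities] at h1
      exact Finsupp.orderIsoMultiset.injective h1
    · by_contra h
      simp [l, h] at hi
    · rw [hl i hi, ← Nat.pos_iff_ne_zero, Multiset.count_pos] at hk
      exact (h2 _ hk).2
    · rw [hl i hi]
      have := Multiset.nodup_iff_count_le_one.1 h3 (k, i)
      rwa [Multiset.count_filter, if_pos hk] at this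

theorem finite_partChoices (F : Finset ι) (e : ℕ →₀ ℕ) : (partChoices σ F e).Finite := by
  classical
  rw [← (bijOn_choiceOfMultiplicities F e).image_eq]
  exact (Finset.finite_toSet _).image _

theorem coeff_prod_factorSeries (F : Finset ι) (e : ℕ →₀ ℕ) :
    MvPowerSeries.coeff e (∏ i ∈ F, factorSeries (σ i)) =
      monomialSign e * ((partChoices σ F e).ncard : ℚ) := by
  classical
  rw [MvPowerSeries.coeff_prod, ← (bijOn_choiceOfMultiplicities F e).image_eq,
    (bijOn_choiceOfMultiplicities F e).injOn.ncard_image, Set.ncard_coe_finset,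
    Finset.card_filter, Nat.cast_sum, Finset.mul_sum]
  refine Finset.sum_congr rfl fun l hl => ?_
  simp only [coeff_factorSeries, Finset.prod_ite_zero]
  rw [Finset.mem_finsuppAntidiag] at hl
  split_ifs
  · rw [← monomialSign_sum, ← hl.1]
    simp
  · simp

end Coverings


/-! ### Triangularity and uniqueness of the expansion -/

section Triangularity

/-- The multiset of nonzero exponents. -/
def exponents (d : ℕ+ →₀ ℕ) : Multiset ℕ := d.support.val.map d

theorem card_exponents (d : ℕ+ →₀ ℕ) : Multiset.card (exponents d) = d.support.card := by
  simp [exponents]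

theorem exponents_single_add {i : ℕ+} {k : ℕ} (hk : k ≠ 0) {b : ℕ+ →₀ ℕ} (hi : i ∉ b.support) :
    exponents (Finsupp.single i k + b) = k ::ₘ exponents b := by
  rw [exponents, Finsupp.support_single_add hi hk, Finset.cons_val, Multiset.map_cons, exponents]
  congr 1
  · simp [Finsupp.notMem_support_iff.1 hi]
  · refine Multiset.map_congr rfl fun j hj => ?_
    have : j ≠ i := by rintro rfl; exact hi hj
    simp [this]

theorem coeff_pBarPrime {k : ℕ} (hk : 0 < k) (d : ℕ+ →₀ ℕ)
    [Decidable (d ≠ 0 ∧ ∀ i, k ∣ d i)] : MvPowerSeries.coeff d (pBarPrime k) =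
      if d ≠ 0 ∧ ∀ i, k ∣ d i then 1 else 0 := by
  classical
  rw [pBarPrime_eq k hk, map_sub, coeff_divisibleSeries, MvPowerSeries.coeff_one]
  by_cases h : d = 0
  · simp [h]
  · simp [h]

theorem eq_single_of_degree_le {d : ℕ+ →₀ ℕ} {i : ℕ+} (h : d.degree ≤ d i) :
    d = Finsupp.single i (d i) := by
  have h1 := Finsupp.single_add_erase i d
  have h2 := congrArg Finsupp.degree h1
  rw [map_add, Finsupp.degree_single] at h2
  have h3 : (d.erase i).degree = 0 := by omega
  rw [Finsupp.degree_eq_zero_iff] at h3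
  rw [h3, add_zero] at h1
  exact h1.symm

/-- Triangularity of the products of the `p̄'_k` with respect to monomials. -/
theorem exponents_of_coeff_ne_zero {μ : Multiset ℕ} (hμ : ∀ k ∈ μ, 0 < k) {d : ℕ+ →₀ ℕ}
    (h : MvPowerSeries.coeff d (μ.map pBarPrime).prod ≠ 0) :
    μ.sum ≤ d.degree ∧ (μ.sum = d.degree → d.support.card ≤ Multiset.card μ ∧
      (d.support.card = Multiset.card μ → exponents d = μ)) := by
  classical
  induction μ using Multiset.induction_on generalizing d with
  | empty =>
    rw [Multiset.map_zero, Multiset.prod_zero, MvPowerSeries.coeff_one] at h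
    have hd : d = 0 := by by_contra hd; simp [hd] at h
    subst hd
    simp [exponents]
  | cons k μ ih =>
    have hk := hμ k (Multiset.mem_cons_self k μ)
    rw [Multiset.map_cons, Multiset.prod_cons, MvPowerSeries.coeff_mul] at h
    obtain ⟨⟨a, b⟩, hab, hne⟩ := Finset.exists_ne_zero_of_sum_ne_zero h
    rw [Finset.HasAntidiagonal.mem_antidiagonal] at hab
    have hb := right_ne_zero_of_mul hne
    have ha := left_ne_zero_of_mul hne
    simp only at ha hb hab
    obtain ⟨ih1, ih2⟩ := ih (fun j hj => hμ j (Multiset.mem_cons_of_mem hj)) hb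
    rw [coeff_pBarPrime hk] at ha
    obtain ⟨ha0, hdvd⟩ : a ≠ 0 ∧ ∀ i, k ∣ a i := by by_contra h'; exact ha (if_neg h')
    obtain ⟨i, hi⟩ := Finsupp.ne_iff.1 ha0
    have hki : k ≤ a i := Nat.le_of_dvd (Nat.pos_of_ne_zero hi) (hdvd i)
    have hai : a i ≤ a.degree := Finsupp.le_degree i a
    have hdeg : d.degree = a.degree + b.degree := by rw [← hab, map_add]
    rw [Multiset.sum_cons]
    refine ⟨by omega, fun heq => ?_⟩
    -- In the lowest degree the factor $\overline p'_k$ contributes only a pure power $x_i^k$. If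
    -- $x_i$ already occurs in $b$, two parts merge and the support stays smaller than the number of
    -- parts.
    have hak : a = Finsupp.single i k := by
      have := eq_single_of_degree_le (d := a) (i := i) (by omega)
      rwa [show a i = k by omega] at this
    obtain ⟨ih3, ih4⟩ := ih2 (by omega)
    rw [Multiset.card_cons, ← hab]
    by_cases hib : i ∈ b.support
    · have hsupp : (a + b).support = b.support := by
        ext j
        by_cases hj : j = i
        · subst hj
          simp only [Finsupp.mem_support_iff, Finsupp.add_apply] at hib ⊢
          omega
        · simp [hak, hj]
      rw [hsupp]
      exact ⟨by omega, fun h => by omega⟩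
    · rw [hak, exponents_single_add hk.ne' hib, Finsupp.support_single_add hib hk.ne',
        Finset.card_cons]
      exact ⟨by omega, fun h => by rw [ih4 (by omega)]⟩

theorem coeff_prod_pBarPrime_nonneg {μ : Multiset ℕ} (hμ : ∀ k ∈ μ, 0 < k) (d : ℕ+ →₀ ℕ) :
    0 ≤ MvPowerSeries.coeff d (μ.map pBarPrime).prod := by
  classical
  induction μ using Multiset.induction_on generalizing d with
  | empty =>
    rw [Multiset.map_zero, Multiset.prod_zero, MvPowerSeries.coeff_one]
    split_ifs <;> simp
  | cons k μ ih =>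
    rw [Multiset.map_cons, Multiset.prod_cons, MvPowerSeries.coeff_mul]
    refine Finset.sum_nonneg fun p _ => mul_nonneg ?_
      (ih (fun j hj => hμ j (Multiset.mem_cons_of_mem hj)) _)
    rw [coeff_pBarPrime (hμ k (Multiset.mem_cons_self k μ))]
    split_ifs <;> simp

theorem exists_exponents_eq {μ : Multiset ℕ} (hμ : ∀ k ∈ μ, 0 < k) :
    ∃ d : ℕ+ →₀ ℕ, exponents d = μ ∧ d.degree = μ.sum ∧
      0 < MvPowerSeries.coeff d (μ.map pBarPrime).prod := by
  classical
  induction μ using Multiset.induction_on with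
  | empty => exact ⟨0, by simp [exponents], by simp, by simp⟩
  | cons k μ ih =>
    have hk := hμ k (Multiset.mem_cons_self k μ)
    have hμ' := fun j hj => hμ j (Multiset.mem_cons_of_mem (a := j) hj)
    obtain ⟨b, hb1, hb2, hb3⟩ := ih hμ'
    -- A fresh variable for each part keeps the parts apart.
    obtain ⟨i, hi⟩ := Infinite.exists_notMem_finset b.support
    refine ⟨Finsupp.single i k + b, by rw [exponents_single_add hk.ne' hi, hb1],
      by rw [map_add, Finsupp.degree_single, hb2, Multiset.sum_cons], ?_⟩
    rw [Multiset.map_cons, Multiset.prod_cons, MvPowerSeries.coeff_mul]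
    have hcoeff : ∀ a : ℕ+ →₀ ℕ, 0 ≤ MvPowerSeries.coeff a (pBarPrime k) := fun a => by
      rw [coeff_pBarPrime hk]; split_ifs <;> simp
    refine Finset.sum_pos' (fun p _ => mul_nonneg (hcoeff _) (coeff_prod_pBarPrime_nonneg hμ' _))
      ⟨(Finsupp.single i k, b), by simp, mul_pos ?_ hb3⟩
    rw [coeff_pBarPrime hk, if_pos]
    · simp
    · refine ⟨by simpa using hk.ne', fun j => ?_⟩
      rw [Finsupp.single_apply]
      split_ifs <;> simp

theorem AnyPartition.ext_parts {l l' : AnyPartition} (h : l.2.parts = l'.2.parts) : l = l' := by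
  obtain ⟨n, p⟩ := l
  obtain ⟨n', p'⟩ := l'
  obtain rfl : n = n' := by rw [← p.parts_sum, ← p'.parts_sum]; exact congrArg _ h
  obtain rfl : p = p' := Nat.Partition.ext h
  rfl

theorem AnyPartition.length_le (l : AnyPartition) : l.length ≤ l.1 := by
  conv_rhs => rw [← l.2.parts_sum]
  have := Multiset.card_nsmul_le_sum (s := l.2.parts) (a := 1) fun k hk => l.2.parts_pos hk
  simpa [AnyPartition.length] using this

theorem le_degree_of_coeff_pBarPrimePart_ne_zero {l : AnyPartition} {d : ℕ+ →₀ ℕ}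
    (h : MvPowerSeries.coeff d (pBarPrimePart l) ≠ 0) : l.1 ≤ d.degree := by
  have := (exponents_of_coeff_ne_zero (fun k hk => l.2.parts_pos hk) h).1
  rwa [l.2.parts_sum] at this

theorem IsPBarPrimeExpansion.unique {f : MvPowerSeries ℕ+ ℚ} {c c' : AnyPartition → ℚ}
    (h : IsPBarPrimeExpansion f c) (h' : IsPBarPrimeExpansion f c') : c' = c := by
  by_contra hne
  obtain ⟨l₁, hl₁⟩ : ∃ l, c' l ≠ c l := Function.ne_iff.1 hne
  -- A disagreement is taken of least size and then of greatest length, that is, least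
  -- $|\lambda|-\ell(\lambda)$. At the monomial with exponents $\lambda$, no other disagreeing
  -- partition contributes: it would have the same size and at least the same length, hence equal
  -- length and equal parts.
  obtain ⟨l₂, hl₂, hmin⟩ := (measure fun l : AnyPartition => l.1).wf.has_min
    {l | c' l ≠ c l} ⟨l₁, hl₁⟩
  obtain ⟨l, ⟨hl, hl21⟩, hmax⟩ := (measure fun l : AnyPartition => l.1 - l.length).wf.has_min
    {l | c' l ≠ c l ∧ l.1 = l₂.1} ⟨l₂, hl₂, rfl⟩
  obtain ⟨d, hd1, hd2, hd3⟩ := exists_exponents_eq (μ := l.2.parts) fun k hk => l.2.parts_pos hk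
  rw [l.2.parts_sum] at hd2
  have hsum : ∑ᶠ m, (c' m * MvPowerSeries.coeff d (pBarPrimePart m) -
      c m * MvPowerSeries.coeff d (pBarPrimePart m)) = 0 := by
    rw [finsum_sub_distrib (h' d).1 (h d).1, ← (h' d).2, ← (h d).2, sub_self]
  rw [finsum_eq_single _ l, ← sub_mul, mul_eq_zero, sub_eq_zero] at hsum
  · exact hsum.elim hl hd3.ne'
  · intro m hm
    rw [← sub_mul, mul_eq_zero, sub_eq_zero]
    by_contra hcon
    push Not at hcon
    obtain ⟨hcm, hcoeff⟩ := hcon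
    obtain ⟨h1, h2⟩ := exponents_of_coeff_ne_zero (fun k hk => m.2.parts_pos hk) hcoeff
    rw [m.2.parts_sum] at h1 h2
    have hmd : m.1 = d.degree := by
      have := hmin m hcm
      simp only [InvImage, WellFoundedRelation.rel] at this
      omega
    obtain ⟨h3, h4⟩ := h2 hmd
    have hcard : d.support.card = l.length := by rw [← card_exponents, hd1]; rfl
    have h5 := hmax m ⟨hcm, by omega⟩
    simp only [InvImage, WellFoundedRelation.rel] at h5
    have hml : Multiset.card m.2.parts = m.length := rfl
    have := m.length_le
    have := l.length_le
    exact hm (AnyPartition.ext_parts ((h4 (by omega)).symm.trans hd1))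

end Triangularity

/-! ### Substituting $\overline p'_k$ for formal variables -/

section Subst

/-- The series `p̄'_k` for `k ≥ 1`, and `0` for `k = 0`. -/
def partSeries (k : ℕ) : MvPowerSeries ℕ+ ℚ := if k = 0 then 0 else pBarPrime k

theorem partSeries_of_pos {k : ℕ} (hk : 0 < k) : partSeries k = pBarPrime k := if_neg hk.ne'

/-- Constant terms vanish, and a monomial $x^d$ occurs in $\overline p'_k$ only for $k\le\deg d$. -/
theorem hasSubst_partSeries : MvPowerSeries.HasSubst partSeries := by
  classical
  refine ⟨fun k => ?_, fun d => (Set.finite_Iic d.degree).subset fun k hk => ?_⟩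
  · rcases Nat.eq_zero_or_pos k with rfl | hk
    · simp [partSeries]
    · rw [partSeries_of_pos hk, ← MvPowerSeries.coeff_zero_eq_constantCoeff_apply,
        coeff_pBarPrime hk]
      simp
  · rcases Nat.eq_zero_or_pos k with rfl | hk'
    · simp
    · rw [Set.mem_ofPred_eq, partSeries_of_pos hk', coeff_pBarPrime hk'] at hk
      obtain ⟨h0, hdvd⟩ : d ≠ 0 ∧ ∀ i, k ∣ d i := by by_contra h'; exact hk (if_neg h')
      obtain ⟨i, hi⟩ := Finsupp.ne_iff.1 h0
      exact (Nat.le_of_dvd (Nat.pos_of_ne_zero hi) (hdvd i)).trans (Finsupp.le_degree i d)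

open MvPowerSeries in
-- Both sides satisfy the same equation after multiplication by $1+\overline p'_n$ or $1+\overline
-- p'_{2n}$, which is nonzero in a domain and can be cancelled.
theorem subst_factorSeries {n : ℕ} (hn : 0 < n) :
    substAlgHom (R := ℚ) hasSubst_partSeries (factorSeries n) =
      multi (1 - (-PowerSeries.X) ^ n) := by
  have hX : ∀ m, 0 < m → substAlgHom (R := ℚ) hasSubst_partSeries (1 + X m) =
      divisibleSeries m := fun m hm => by
    rw [map_add, map_one, substAlgHom_X, partSeries_of_pos hm, pBarPrime_eq m hm,
      add_sub_cancel]
  have hne : ∀ m, divisibleSeries m ≠ 0 := fun m h => by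
    classical
    have h1 := coeff_divisibleSeries m 0
    rw [h] at h1
    simp at h1
  rcases Nat.even_or_odd n with he | ho
  · refine mul_right_cancel₀ (hne n) ?_
    rw [multi_mul_divisibleSeries_of_even hn he, ← hX n hn, ← map_mul,
      factorSeries_mul_of_even he, map_one]
  · refine mul_right_cancel₀ (hne (2 * n)) ?_
    rw [multi_mul_divisibleSeries_of_odd ho, ← hX (2 * n) (by omega), ← map_mul,
      factorSeries_mul_of_odd ho, hX n hn]

/-- The exponent vector of multiplicities of the parts. -/
def AnyPartition.multiplicities (l : AnyPartition) : ℕ →₀ ℕ := Multiset.toFinsupp l.2.parts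

theorem AnyPartition.multiplicities_injective : Function.Injective multiplicities :=
  fun _ _ h => ext_parts (Multiset.toFinsupp.injective h)

theorem prod_multiplicities (l : AnyPartition) :
    (l.multiplicities.prod fun k m => partSeries k ^ m) = pBarPrimePart l := by
  rw [pBarPrimePart, Finset.prod_multiset_map_count, Finsupp.prod]
  refine Finset.prod_congr rfl fun k hk => ?_
  rw [partSeries_of_pos (l.2.parts_pos (by simpa [AnyPartition.multiplicities] using hk))]
  rfl

theorem mem_range_multiplicities {e : ℕ →₀ ℕ}
    (h : (e.prod fun k m => partSeries k ^ m) ≠ 0) :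
    e ∈ Set.range AnyPartition.multiplicities := by
  have h0 : 0 ∉ e.support := fun h0 => h (Finset.prod_eq_zero h0 (by
    simp [partSeries, Finsupp.mem_support_iff.1 h0]))
  refine ⟨⟨_, ⟨Finsupp.toMultiset e, fun {i} hi => Nat.pos_of_ne_zero ?_, rfl⟩⟩, ?_⟩
  · rintro rfl
    exact h0 (by simpa using hi)
  · simp [AnyPartition.multiplicities]

/-- The exponent of the sign is $|\lambda|+\ell(\lambda)$, of the same parity as
$|\lambda|-\ell(\lambda)$. -/
theorem monomialSign_multiplicities (l : AnyPartition) :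
    monomialSign l.multiplicities = (-1) ^ (l.1 - l.length) := by
  have h : (l.multiplicities.sum fun k m => (k + 1) * m) = l.1 + l.length := by
    conv_rhs => rw [← l.2.parts_sum]
    rw [AnyPartition.length, Finset.sum_multiset_count, ← Multiset.toFinset_sum_count_eq,
      ← Finset.sum_add_distrib, Finsupp.sum]
    refine Finset.sum_congr rfl fun k _ => ?_
    simp only [AnyPartition.multiplicities, Multiset.toFinsupp_apply, smul_eq_mul]
    ring
  obtain ⟨m, hm⟩ := Nat.exists_eq_add_of_le l.length_le
  rw [monomialSign, h, hm, Nat.add_sub_cancel_left, add_right_comm, pow_add, ← two_mul, pow_mul]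
  simp

/-- Comparison of expansions in the `p̄'_λ` with substitutions, one monomial at a time. -/
theorem isPBarPrimeExpansion_of_subst {f : MvPowerSeries ℕ+ ℚ} {c : AnyPartition → ℚ}
    (h : ∀ d : ℕ+ →₀ ℕ, ∃ g : MvPowerSeries ℕ ℚ,
      MvPowerSeries.coeff d (MvPowerSeries.substAlgHom (R := ℚ) hasSubst_partSeries g) =
        MvPowerSeries.coeff d f ∧
      ∀ l : AnyPartition, l.1 ≤ d.degree → MvPowerSeries.coeff l.multiplicities g = c l) :
    IsPBarPrimeExpansion f c := by
  intro d
  obtain ⟨g, hg, hc⟩ := h d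
  set F : (ℕ →₀ ℕ) → ℚ := fun e => MvPowerSeries.coeff e g •
    MvPowerSeries.coeff d (e.prod fun k m => partSeries k ^ m) with hF
  have hFc : ∀ l, c l * MvPowerSeries.coeff d (pBarPrimePart l) = F l.multiplicities := by
    intro l
    rw [hF]
    simp only [prod_multiplicities, smul_eq_mul]
    -- Partitions larger than $\deg d$ do not contribute to $x^d$, so $g$ need only have the right
    -- coefficients up to that size.
    by_cases hl : l.1 ≤ d.degree
    · rw [hc l hl]
    · have : MvPowerSeries.coeff d (pBarPrimePart l) = 0 := by
        by_contra h
        exact hl (le_degree_of_coeff_pBarPrimePart_ne_zero h)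
      rw [this, mul_zero, mul_zero]
  have hfin : (Function.support F).Finite :=
    MvPowerSeries.coeff_subst_finite hasSubst_partSeries g d
  simp only [hFc]
  refine ⟨(hfin.preimage AnyPartition.multiplicities_injective.injOn).subset fun l hl => hl, ?_⟩
  rw [← hg, MvPowerSeries.substAlgHom_apply, MvPowerSeries.coeff_subst hasSubst_partSeries,
    ← finsum_mem_range AnyPartition.multiplicities_injective, ← finsum_mem_univ]
  -- Exponent vectors not coming from a partition involve the index $0$, where `partSeries`
  -- vanishes.
  refine finsum_mem_inter_support_eq' _ _ _ fun e he => iff_of_true (Set.mem_univ e) ?_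
  refine mem_range_multiplicities fun h0 => he ?_
  simp only [h0, map_zero, smul_zero]

end Subst

/-! ### Assembling the expansion of the Kromatic symmetric function -/

section Main

variable {V : Type*} [LinearOrder V] (G : SimpleGraph V)

/-- The heap of a word. -/
def heapOf (w : List V) : Heap G := (Heap.exists_mem_words G w).choose

variable {G}

theorem mem_words_heapOf (w : List V) : w ∈ (heapOf G w).words :=
  (Heap.exists_mem_words G w).choose_spec

theorem eq_of_heapOf_eq {w w' : List V} (hw : IsStd G w) (hw' : IsStd G w')
    (h : heapOf G w = heapOf G w') : w = w' :=
  hw.eq hw' (Heap.traceEquiv_of_mem_words (mem_words_heapOf w) (h ▸ mem_words_heapOf w'))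

variable [Fintype V]

open scoped Classical in
variable (G) in
/-- The Lyndon heaps of size at most `N` that use no vertex of `B`. -/
def lyndonHeaps (B : Finset V) (N : ℕ) : Finset (Heap G) := (lyndonWords G B N).image (heapOf G)

theorem mem_lyndonHeaps {B : Finset V} {N : ℕ} {H : Heap G} :
    H ∈ lyndonHeaps G B N ↔ H.IsLyndon ∧ H.size ≤ N ∧ ∀ v ∈ B, ¬ H.Uses v := by
  classical
  rw [lyndonHeaps, Finset.mem_image]
  constructor
  · rintro ⟨w, hw, rfl⟩
    obtain ⟨h1, h2, h3, h4⟩ := mem_lyndonWords.1 hw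
    have hmem := mem_words_heapOf (G := G) w
    refine ⟨Heap.isLyndon_of_isLyndonWord hmem h1 h2, by rwa [Heap.size_of_mem_words hmem],
      fun v hv hu => ?_⟩
    rw [Heap.uses_iff_of_mem_words hmem] at hu
    exact h4 v hu hv
  · rintro ⟨h1, h2, h3⟩
    obtain ⟨w, hw, hs⟩ := H.exists_isStd_mem_words
    refine ⟨w, mem_lyndonWords.2 ⟨hs, Heap.isLyndonWord_of_isLyndon hw hs h1,
      by rwa [← Heap.size_of_mem_words hw], fun b hb hB => ?_⟩,
      Heap.eq_of_traceEquiv (mem_words_heapOf w) hw (TraceEquiv.refl w)⟩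
    exact h3 b hB ((Heap.uses_iff_of_mem_words hw b).2 hb)

theorem Heap.IsLyndon.size_pos {H : Heap G} (h : H.IsLyndon) : 0 < H.size := by
  obtain ⟨w, hw, hs⟩ := H.exists_isStd_mem_words
  rw [size_of_mem_words hw]
  exact List.length_pos_of_ne_nil (isLyndonWord_of_isLyndon hw hs h).1

theorem coeff_prod_lyndonHeaps (B : Finset V) {n N : ℕ} (hn : n ≤ N) :
    PowerSeries.coeff n (∏ H ∈ lyndonHeaps G B N, (1 - (-PowerSeries.X : PowerSeries ℚ) ^ H.size)) =
      (((stableSets G B).filter fun S => S.card = n).card : ℚ) := by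
  classical
  rw [lyndonHeaps, Finset.prod_image, ← coeff_prod_lyndonWords B hn]
  · congr 1
    exact Finset.prod_congr rfl fun w _ => by rw [Heap.size_of_mem_words (mem_words_heapOf w)]
  · intro w hw w' hw' h
    exact eq_of_heapOf_eq (mem_lyndonWords.1 hw).1 (mem_lyndonWords.1 hw').1 h

variable (G) in
/-- The series in the `p̄'_k` whose terms of weight at most `N` are those of the expansion of the
Kromatic symmetric function. -/
def truncatedExpansion (N : ℕ) : MvPowerSeries ℕ ℚ :=
  ∑ B : Finset V, (-1 : ℚ) ^ B.card • ∏ H ∈ lyndonHeaps G B N, factorSeries H.size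

/-- For each $B$ the product over Lyndon heaps turns into $\prod_i\prod_L(1-(-x_i)^{|L|})$. Only its
coefficients at $x_i^{d_i}$ matter, and $d_i\le\deg d$ makes the truncation exact. -/
theorem coeff_subst_truncatedExpansion (d : ℕ+ →₀ ℕ) :
    MvPowerSeries.coeff d (MvPowerSeries.substAlgHom (R := ℚ) hasSubst_partSeries
      (truncatedExpansion G d.degree)) = MvPowerSeries.coeff d (kromatic G) := by
  rw [coeff_kromatic, truncatedExpansion, map_sum, map_sum]
  refine Finset.sum_congr rfl fun B _ => ?_
  have hpos : ∀ H ∈ lyndonHeaps G B d.degree, 0 < H.size := fun H hH =>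
    (mem_lyndonHeaps.1 hH).1.size_pos
  rw [map_smul, map_smul, smul_eq_mul, map_prod,
    Finset.prod_congr rfl fun H hH => subst_factorSeries (hpos H hH),
    ← multi_prod _ fun H hH => coeff_zero_one_sub (hpos H hH), coeff_multi]
  congr 1
  exact Finset.prod_congr rfl fun i _ => coeff_prod_lyndonHeaps B (Finsupp.le_degree i d)

theorem lyndonCoverings_eq (l : AnyPartition) {N : ℕ} (hN : l.1 ≤ N) :
    lyndonCoverings G l = {M ∈ partChoices Heap.size (lyndonHeaps G ∅ N) l.multiplicities |
      ∀ v, ¬ ∀ x ∈ M, ¬ x.2.Uses v} := by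
  ext M
  simp only [lyndonCoverings, partChoices, Set.mem_ofPred_eq, AnyPartition.multiplicities,
    Multiset.toFinsupp_toMultiset, mem_lyndonHeaps, Finset.notMem_empty, not_forall, not_not]
  constructor
  · rintro ⟨h1, h2, h3, h4⟩
    refine ⟨⟨h1, fun x hx => ⟨⟨(h2 x hx).1, ?_, by simp⟩, ?_⟩, h4⟩, fun v => ?_⟩
    · have hx1 : x.1 ≤ l.1 := by
        rw [← l.2.parts_sum, ← h1]
        exact Multiset.single_le_sum (fun _ _ => Nat.zero_le _) _ (Multiset.mem_map_of_mem _ hx)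
      rcases (h2 x hx).2 with h | h <;> omega
    · exact (h2 x hx).2
    · obtain ⟨x, hx, hu⟩ := h3 v
      exact ⟨x, hx, hu⟩
  · rintro ⟨⟨h1, h2, h4⟩, h3⟩
    refine ⟨h1, fun x hx => ⟨(h2 x hx).1.1, (h2 x hx).2⟩, fun v => ?_, h4⟩
    obtain ⟨x, hx, hu⟩ := h3 v
    exact ⟨x, hx, hu⟩

theorem partChoices_lyndonHeaps (B : Finset V) (N : ℕ) (e : ℕ →₀ ℕ) :
    partChoices Heap.size (lyndonHeaps G B N) e =
      {M ∈ partChoices Heap.size (lyndonHeaps G ∅ N) e | ∀ v ∈ B, ∀ x ∈ M, ¬ x.2.Uses v} := by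
  ext M
  simp only [partChoices, Set.mem_ofPred_eq, mem_lyndonHeaps]
  constructor
  · rintro ⟨h1, h2, h3⟩
    exact ⟨⟨h1, fun x hx => ⟨⟨(h2 x hx).1.1, (h2 x hx).1.2.1, by simp⟩, (h2 x hx).2⟩, h3⟩,
      fun v hv x hx => (h2 x hx).1.2.2 v hv⟩
  · rintro ⟨⟨h1, h2, h3⟩, h4⟩
    exact ⟨h1, fun x hx => ⟨⟨(h2 x hx).1.1, (h2 x hx).1.2.1, fun v hv => h4 v hv x hx⟩,
      (h2 x hx).2⟩, h3⟩

/-- The signed sum over $B$ of the families avoiding $B$ counts, by inclusion–exclusion, the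
families that miss no vertex. Heaps are no larger than their parts, so size at most $N$ loses none.
-/
theorem coeff_truncatedExpansion (l : AnyPartition) {N : ℕ} (hN : l.1 ≤ N) :
    MvPowerSeries.coeff l.multiplicities (truncatedExpansion G N) =
      (-1) ^ (l.1 - l.length) * ((lyndonCoverings G l).ncard : ℚ) := by
  classical
  set K := (finite_partChoices (σ := Heap.size) (lyndonHeaps G ∅ N) l.multiplicities).toFinset
    with hK
  have h1 := card_forall_not_eq_sum K fun M (v : V) => ∀ x ∈ M, ¬ x.2.Uses v
  have h2 : lyndonCoverings G l = (K.filter fun M => ∀ v, ¬ ∀ x ∈ M, ¬ x.2.Uses v : Finset _) := by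
    rw [lyndonCoverings_eq l hN]
    ext M
    simp [hK]
  have h3 : ∀ B : Finset V, partChoices Heap.size (lyndonHeaps G B N) l.multiplicities =
      (K.filter fun M => ∀ v ∈ B, ∀ x ∈ M, ¬ x.2.Uses v : Finset _) := by
    intro B
    rw [partChoices_lyndonHeaps]
    ext M
    simp [hK]
  rw [h2, Set.ncard_coe_finset, truncatedExpansion, map_sum, ← monomialSign_multiplicities]
  have h4 : ((K.filter fun M => ∀ v, ¬ ∀ x ∈ M, ¬ x.2.Uses v).card : ℚ) =
      ∑ B : Finset V, (-1 : ℚ) ^ B.card *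
        ((K.filter fun M => ∀ v ∈ B, ∀ x ∈ M, ¬ x.2.Uses v).card : ℚ) := by
    convert h1
  rw [h4, Finset.mul_sum]
  refine Finset.sum_congr rfl fun B _ => ?_
  rw [map_smul, coeff_prod_factorSeries, h3, Set.ncard_coe_finset, smul_eq_mul]
  ring

theorem finite_lyndonCoverings (l : AnyPartition) : (lyndonCoverings G l).Finite := by
  rw [lyndonCoverings_eq l le_rfl]
  exact (finite_partChoices _ _).subset fun _ h => h.1

end Main

end KromaticHeaps

end

theorem theorem1p4 {V : Type*} [Fintype V] [LinearOrder V] (G : SimpleGraph V) :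
    ∃ c : KromaticHeaps.AnyPartition → ℚ,
      KromaticHeaps.IsPBarPrimeExpansion (KromaticHeaps.kromatic G) c ∧
      (∀ c', KromaticHeaps.IsPBarPrimeExpansion (KromaticHeaps.kromatic G) c' → c' = c) ∧
      ∀ l : KromaticHeaps.AnyPartition,
        (KromaticHeaps.lyndonCoverings G l).Finite ∧
        (-1 : ℚ) ^ (l.1 - l.length) * c l = ((KromaticHeaps.lyndonCoverings G l).ncard : ℚ) := by
  have h : KromaticHeaps.IsPBarPrimeExpansion (KromaticHeaps.kromatic G) fun l =>
      (-1) ^ (l.1 - l.length) * ((KromaticHeaps.lyndonCoverings G l).ncard : ℚ) :=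
    KromaticHeaps.isPBarPrimeExpansion_of_subst fun d =>
      ⟨KromaticHeaps.truncatedExpansion G d.degree,
        KromaticHeaps.coeff_subst_truncatedExpansion d,
        fun l hl => KromaticHeaps.coeff_truncatedExpansion l hl⟩
  refine ⟨_, h, fun c' h' => h.unique h', fun l =>
    ⟨KromaticHeaps.finite_lyndonCoverings l, ?_⟩⟩
  rw [← mul_assoc, ← mul_pow]
  simp
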